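/- Let $s\ge k\ge 1$ be integers and $\lambda,\mu>0$. Consider a $1$-barrier (start barrier only) system: there are $s$ workers, every job consists of $k$ tasks, and jobs are served in order of arrival. A job starts, with all its $k$ tasks simultaneously on $k$ idle workers, as soon as it has arrived, all earlier jobs have started, and at least $k$ workers are idle; each worker becomes idle again when its own task is complete, and the job departs when all its tasks are complete. The system is initially empty, job inter-arrival times are i.i.d. exponential with rate $\lambda$, and task service times are i.i.d. exponential with rate $\mu$, independent of the arrivals. Write $H_n=\sum_{i=1}^n 1/i$ (with $H_0=0$) and $\varrho = k\lambda/(s\mu)$ for the utilization. (i) Backlog. Suppose that an unlimited supply of jobs is waiting from time $0$ on. Number the jobs $0,1,2,\dots$, and let $n$ be any index with $(n+1)k\ge s$ (so that the workers have been filled). Almost surely all $s$ workers are busy immediately after the start of each such job $n$. The times between the start of job $n$ and the start of job $n+1$, for these $n$, are independent, and each is distributed as the $k$-th order statistic (the $k$-th smallest) of $s$ independent exponential random variables of rate $\mu$; it is integrable with mean $(H_s-H_{s-k})/\mu$. (ii) Stability. Call the system stable if the delay of the $n$-th job converges in distribution, as $n\to\infty$, to a finite random variable. Then, both for the waiting time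 (start minus arrival) and for the sojourn time (departure minus arrival) as the delay, the system is stable if and only if $$\varrho < \frac{k}{s\,(H_s-H_{s-k})} = \frac{1}{\sum_{j=0}^{k-1}\frac{1}{k-j\frac{k}{s}}}.$$ (iii) Limit. The bound tends to $1$ as $k/s\to 0$: for every $\varepsilon>0$ there is $\delta>0$ such that for all integers $1\le k\le s$ with $k/s<\delta$, $$\Bigl|\frac{k}{s\,(H_s-H_{s-k})}-1\Bigr|<\varepsilon .$$ -/

import Mathlib

open MeasureTheory ProbabilityTheory Filter Topology

noncomputable section

namespace BEM

/-- The `k`-th order statistic (the `k`-th smallest entry, `1 ≤ k ≤ s`) of `x`: the least `t` such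
that at least `k` of the entries of `x` are `≤ t`. -/
def orderStat {s : ℕ} (k : ℕ) (x : Fin s → ℝ) : ℝ :=
  sInf {t : ℝ | k ≤ (Finset.univ.filter fun i => x i ≤ t).card}

/-- A job of `k` tasks with service times `q` starts at time `v`, while worker `i` is free from time
`F i` on. The tasks go to the `k` workers with the smallest times `F i`, and each worker is occupied
until its own task is complete (there is no departure barrier). The result is the new vector of
times at which the workers become free. -/
def assign {s k : ℕ} (F : Fin s → ℝ) (v : ℝ) (q : Fin k → ℝ) : Fin s → ℝ := fun i =>
  if h : ((Tuple.sort F).symm i : ℕ) < k then v + q ⟨_, h⟩ else F i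

/-- One path of the start-barrier system with `s` workers and `k` tasks per job, initially empty.
Jobs are numbered `0, 1, 2, …`, served in order of arrival; job `n` arrives at time `A n`
and its `k` tasks have the service times `q n 0, …, q n (k - 1)`. The value `freeTime s A q n i`
is the time at which worker `i` has completed all its tasks of the jobs `0, …, n - 1`.
Job `n` starts, with all its tasks at once, as soon as it has arrived and `k` workers are idle
(and the jobs before it have started, which is then automatic). -/
def freeTime (s : ℕ) {k : ℕ} (A : ℕ → ℝ) (q : ℕ → Fin k → ℝ) : ℕ → Fin s → ℝ
  | 0 => fun _ => 0
  | n + 1 =>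
      assign (freeTime s A q n) (max (A n) (orderStat k (freeTime s A q n))) (q n)

/-- The time at which job `n` starts service. -/
def startTime (s : ℕ) {k : ℕ} (A : ℕ → ℝ) (q : ℕ → Fin k → ℝ) (n : ℕ) : ℝ :=
  max (A n) (orderStat k (freeTime s A q n))

/-- The time at which job `n` departs: all its `k` tasks are complete. -/
def departTime (s : ℕ) {k : ℕ} (A : ℕ → ℝ) (q : ℕ → Fin k → ℝ) (n : ℕ) : ℝ :=
  startTime s A q n + ⨆ i, q n i

/-- The waiting time of job `n`. -/
def waitingTime (s : ℕ) {k : ℕ} (A : ℕ → ℝ) (q : ℕ → Fin k → ℝ) (n : ℕ) : ℝ :=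
  startTime s A q n - A n

/-- The sojourn time of job `n`. -/
def sojournTime (s : ℕ) {k : ℕ} (A : ℕ → ℝ) (q : ℕ → Fin k → ℝ) (n : ℕ) : ℝ :=
  departTime s A q n - A n

/-- The arrival times of the jobs, from the inter-arrival times. -/
def arrivalTime (t : ℕ → ℝ) (n : ℕ) : ℝ := ∑ i ∈ Finset.range (n + 1), t i

/-- The time between the starts of the jobs `n` and `n + 1` in the backlogged system, in which an
unlimited supply of jobs is waiting from time `0` on. -/
def backlogGap (s : ℕ) {k : ℕ} (q : ℕ → Fin k → ℝ) (n : ℕ) : ℝ :=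
  startTime s (fun _ => 0) q (n + 1) - startTime s (fun _ => 0) q n

/-- The law of the `k`-th order statistic of `s` independent exponential times of rate `μ`. -/
def expOrderStatLaw (s k : ℕ) (μ : ℝ) : Measure ℝ :=
  (Measure.pi fun _ : Fin s => expMeasure μ).map (orderStat k)

/-- The delay sequence `X` is stable: it converges in distribution to a finite random variable. -/
def StableDelay {Ω : Type*} [MeasurableSpace Ω] (P : Measure Ω) [IsProbabilityMeasure P]
    (X : ℕ → Ω → ℝ) : Prop :=
  ∃ (ν : Measure ℝ) (_ : IsProbabilityMeasure ν),
    TendstoInDistribution X atTop (id : ℝ → ℝ) (fun _ => P) ν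

/-- The utilization: arrival rate `lam` of jobs, `k` tasks per job, `s` workers of rate `μ`. -/
def utilization (s k : ℕ) (lam μ : ℝ) : ℝ := k * lam / (s * μ)

/-- The maximum stable utilization `k / (s (H_s - H_{s-k}))`. -/
def maxUtilization (s k : ℕ) : ℝ :=
  (k : ℝ) / (s * ((harmonic s : ℝ) - (harmonic (s - k) : ℝ)))

end BEM

end

/-!
Under backlog the next job starts when `k` of the `s` workers have become idle. By the
memorylessness of the exponential law, the residual service times at a job start, once all workers
are filled, are i.i.d. exponential of rate `μ`, and they remain so, independently of the length of
the gap, after the gap has been subtracted and `k` fresh service times have been added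
(`map_orderStat_residual`). Hence the gaps are independent copies of the `k`-th order statistic of
`s` exponential times (`IsServiceProcess.map_residual_restrict`, `IsServiceProcess.iIndepFun_gap`);
its mean `(H_s - H_{s-k}) / μ` comes from integrating the binomial tail (`integral_orderStat`). The
stability condition says that this mean is less than the mean inter-arrival time `1 / lam`
(`utilization_lt_maxUtilization_iff`).

Paths are compared by domination (`Dominated`): if the sorted vector of the times at which the
workers become free is at most another one, entry by entry and up to a threshold that all later
arrivals exceed, then this persists when the same jobs are served in both systems
(`freeTime_dominated`).

*Instability.* A job starts no earlier than under backlog (`backlogStart_le_startTime`), so its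
delay is at least the backlogged start time minus its arrival time. If the mean gap is at least
`1 / lam`, this difference has nonnegative drift, and its two parts are independent. The central
limit theorem for each part shows that it exceeds every fixed bound with a probability that does not
tend to `0`, which also covers the critical case (`lt_of_stableDelay`).

*Stability.* Feeding the first `n + 1` jobs in reverse order does not change the law of the delay of
the last one, and makes it nondecreasing in `n` (`monotone_revWaitingTime`). It remains to bound the
reversed waiting times almost surely. The jobs are cut into long blocks; from the time at which all
workers are free and a block has arrived, the block takes at most its drain time under backlog
(`freeTime_add_le`), so that the waiting time is bounded by the supremum of a walk whose steps
are i.i.d. block times minus inter-arrival times (`revWaitingTime_mul_le`). The mean drain time is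
the number of jobs times the mean gap up to a constant (`IsServiceProcess.integral_drainTime_le`), so
for long blocks the walk drifts to `-∞` by the strong law of large numbers.

The limit of the bound follows from `1 - k / s ≤ maxUtilization s k ≤ 1`, since the terms of
`H_s - H_{s-k}` lie between `1 / s` and `1 / (s - k)`.
-/

noncomputable section

namespace BEM

/-! ### Ranks and order statistics -/

section Rank

variable {s : ℕ}

/-- The strict order on workers by which `Tuple.sort x` enumerates them: by value, and by index
among equal values. -/
def lexLT (x : Fin s → ℝ) (j i : Fin s) : Prop := x j < x i ∨ (x j = x i ∧ j < i)

/-- The position of worker `i` in the sorted enumeration, as a number of predecessors. -/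
def rank (x : Fin s → ℝ) (i : Fin s) : ℕ :=
  open Classical in (Finset.univ.filter fun j => lexLT x j i).card

lemma lexLT_sort_iff (x : Fin s → ℝ) (a b : Fin s) :
    lexLT x (Tuple.sort x a) (Tuple.sort x b) ↔ a < b := by
  have key : ∀ a b : Fin s, a < b → lexLT x (Tuple.sort x a) (Tuple.sort x b) := by
    intro a b hab
    have h := (Tuple.eq_sort_iff (f := x) (σ := Tuple.sort x)).1 rfl
    rcases (h.1 hab.le).lt_or_eq with h1 | h1
    · exact Or.inl h1
    · exact Or.inr ⟨h1, h.2 a b hab h1⟩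
  refine ⟨fun h => ?_, key a b⟩
  by_contra hab
  rcases (not_lt.1 hab).lt_or_eq with h1 | h1
  · have h2 := key b a h1
    unfold lexLT at h h2
    rcases h with h | h <;> rcases h2 with h2 | h2
    · linarith
    · linarith [h2.1]
    · linarith [h.1]
    · exact absurd h.2 h2.2.not_gt
  · subst h1
    simp [lexLT] at h

lemma rank_eq (x : Fin s → ℝ) (i : Fin s) : rank x i = ((Tuple.sort x).symm i : ℕ) := by
  classical
  obtain ⟨r, rfl⟩ := (Tuple.sort x).surjective i
  rw [Equiv.symm_apply_apply, rank]
  have : (Finset.univ.filter fun j => lexLT x j (Tuple.sort x r)) =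
      (Finset.Iio r).map (Tuple.sort x).toEmbedding := by
    ext j
    obtain ⟨a, rfl⟩ := (Tuple.sort x).surjective j
    simp [lexLT_sort_iff]
  convert congrArg Finset.card this
  simp

lemma rank_sort (x : Fin s → ℝ) (r : Fin s) : rank x (Tuple.sort x r) = r := by
  rw [rank_eq, Equiv.symm_apply_apply]

lemma rank_lt (x : Fin s → ℝ) (i : Fin s) : rank x i < s := by
  rw [rank_eq]; exact Fin.isLt _

lemma rank_injective (x : Fin s → ℝ) : Function.Injective (rank x) := by
  intro i j h
  rw [rank_eq, rank_eq] at h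
  exact (Tuple.sort x).symm.injective (Fin.ext h)

lemma le_of_rank_le {x : Fin s → ℝ} {i j : Fin s} (h : rank x i ≤ rank x j) : x i ≤ x j := by
  obtain ⟨a, rfl⟩ := (Tuple.sort x).surjective i
  obtain ⟨b, rfl⟩ := (Tuple.sort x).surjective j
  rw [rank_sort, rank_sort] at h
  exact Tuple.monotone_sort x h

lemma measurable_rank (i : Fin s) : Measurable fun x : Fin s → ℝ => rank x i := by
  classical
  have : (fun x : Fin s → ℝ => rank x i) = fun x => ∑ j, if lexLT x j i then 1 else 0 := by
    funext x
    rw [rank, Finset.card_filter]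
  rw [this]
  refine Finset.measurable_sum _ fun j _ => Measurable.ite ?_ measurable_const measurable_const
  have h1 : MeasurableSet {x : Fin s → ℝ | x j < x i} :=
    measurableSet_lt (measurable_pi_apply _) (measurable_pi_apply _)
  have h2 : MeasurableSet {x : Fin s → ℝ | x j = x i} :=
    measurableSet_eq_fun (measurable_pi_apply _) (measurable_pi_apply _)
  by_cases hji : j < i
  · have h3 : {x : Fin s → ℝ | lexLT x j i} = {x | x j < x i} ∪ {x | x j = x i} := by
      ext x; simp [lexLT, hji]
    exact h3 ▸ h1.union h2
  · simpa only [lexLT, hji, and_false, or_false] using h1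

lemma orderStat_eq_sort {k : ℕ} (hk : 1 ≤ k) (hks : k ≤ s) (x : Fin s → ℝ) :
    orderStat k x = x (Tuple.sort x ⟨k - 1, by omega⟩) := by
  have hset : {t : ℝ | k ≤ (Finset.univ.filter fun i => x i ≤ t).card} =
      Set.Ici (x (Tuple.sort x ⟨k - 1, by omega⟩)) := by
    ext t
    have h := Tuple.lt_card_le_iff_apply_le_of_monotone (a := t)
      (j := (⟨k - 1, by omega⟩ : Fin s)) (Tuple.monotone_sort x)
    have hc : (Finset.univ.filter fun i => (x ∘ Tuple.sort x) i ≤ t).card =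
        (Finset.univ.filter fun i => x i ≤ t).card := by
      rw [← Finset.card_map (Tuple.sort x).toEmbedding]
      congr 1
      ext j
      obtain ⟨a, rfl⟩ := (Tuple.sort x).surjective j
      simp
    rw [hc] at h
    simp only [Function.comp] at h
    rw [Set.mem_ofPred_eq, Set.mem_Ici, ← h]
    omega
  rw [orderStat, hset, csInf_Ici]

/-- The `k`-th order statistic is the value at the worker of rank `k - 1`. -/
lemma orderStat_eq_of_rank {k : ℕ} (hk : 1 ≤ k) {x : Fin s → ℝ} {i : Fin s}
    (hi : rank x i = k - 1) : orderStat k x = x i := by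
  have := rank_lt x i
  rw [orderStat_eq_sort hk (by omega)]
  congr 1
  rw [← Equiv.eq_symm_apply]
  apply Fin.ext
  rw [← rank_eq]
  exact hi.symm

lemma orderStat_eq_sum {k : ℕ} (hk : 1 ≤ k) (hks : k ≤ s) (x : Fin s → ℝ) :
    orderStat k x = ∑ i, if rank x i = k - 1 then x i else 0 := by
  rw [Finset.sum_eq_single (Tuple.sort x ⟨k - 1, by omega⟩)]
  · rw [if_pos (rank_sort x _), orderStat_eq_sort hk hks]
  · intro j _ hj
    rw [if_neg]
    intro h
    apply hj
    apply rank_injective x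
    rw [h, rank_sort]
  · simp

lemma measurable_orderStat {k : ℕ} (hk : 1 ≤ k) (hks : k ≤ s) :
    Measurable (orderStat k : (Fin s → ℝ) → ℝ) := by
  have : (orderStat k : (Fin s → ℝ) → ℝ) =
      fun x => ∑ i, if rank x i = k - 1 then x i else 0 := by
    funext x; exact orderStat_eq_sum hk hks x
  rw [this]
  refine Finset.measurable_sum _ fun i _ => Measurable.ite ?_ (measurable_pi_apply _)
    measurable_const
  exact measurable_rank i (measurableSet_singleton (k - 1))

lemma lt_orderStat_iff {k : ℕ} (hk : 1 ≤ k) (hks : k ≤ s) (x : Fin s → ℝ) (t : ℝ) :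
    t < orderStat k x ↔ (Finset.univ.filter fun i => x i ≤ t).card < k := by
  have h := Tuple.lt_card_le_iff_apply_le_of_monotone (a := t)
      (j := (⟨k - 1, by omega⟩ : Fin s)) (Tuple.monotone_sort x)
  have hc : (Finset.univ.filter fun i => (x ∘ Tuple.sort x) i ≤ t).card =
      (Finset.univ.filter fun i => x i ≤ t).card := by
    rw [← Finset.card_map (Tuple.sort x).toEmbedding]
    congr 1
    ext j
    obtain ⟨a, rfl⟩ := (Tuple.sort x).surjective j
    simp
  rw [hc] at h
  simp only [Function.comp] at h
  rw [orderStat_eq_sort hk hks, ← not_le, ← h]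
  omega

lemma exists_orderStat_eq {k : ℕ} (hk : 1 ≤ k) (hks : k ≤ s) (x : Fin s → ℝ) :
    ∃ i, orderStat k x = x i := ⟨_, orderStat_eq_sort hk hks x⟩

/-- The task given to worker `i` is the one numbered by the rank of `i`. -/
lemma assign_apply {k : ℕ} (F : Fin s → ℝ) (v : ℝ) (q : Fin k → ℝ) (i : Fin s) :
    assign F v q i = if h : rank F i < k then v + q ⟨rank F i, h⟩ else F i := by
  simp only [assign, rank_eq]

lemma assign_sort {k : ℕ} (F : Fin s → ℝ) (v : ℝ) (q : Fin k → ℝ) (j : Fin s) :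
    assign F v q (Tuple.sort F j) =
      if h : (j : ℕ) < k then v + q ⟨j, h⟩ else F (Tuple.sort F j) := by
  simp [assign]

lemma rank_sub_const (x : Fin s → ℝ) (c : ℝ) : rank (fun i => x i - c) = rank x := by
  funext i
  unfold rank
  congr 1
  ext j
  simp only [Finset.mem_filter, Finset.mem_univ, true_and]
  simp [lexLT]

lemma orderStat_sub_const {k : ℕ} (hk : 1 ≤ k) (hks : k ≤ s) (x : Fin s → ℝ) (c : ℝ) :
    orderStat k (fun i => x i - c) = orderStat k x - c := by
  have h := rank_sort x ⟨k - 1, by omega⟩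
  rw [orderStat_eq_of_rank hk h, orderStat_eq_of_rank hk (i := Tuple.sort x ⟨k - 1, by omega⟩)]
  rw [rank_sub_const, h]

lemma assign_sub_const {k : ℕ} (F : Fin s → ℝ) (v c : ℝ) (q : Fin k → ℝ) (i : Fin s) :
    assign (fun i => F i - c) (v - c) q i = assign F v q i - c := by
  rw [assign_apply, assign_apply, rank_sub_const]
  split_ifs
  · ring
  · rfl

lemma measurable_assign {k : ℕ} :
    Measurable fun p : (Fin s → ℝ) × ℝ × (Fin k → ℝ) => assign p.1 p.2.1 p.2.2 := by
  refine measurable_pi_iff.2 fun i => ?_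
  have : (fun p : (Fin s → ℝ) × ℝ × (Fin k → ℝ) => assign p.1 p.2.1 p.2.2 i) = fun p =>
      if rank p.1 i < k then p.2.1 + ∑ l : Fin k, (if rank p.1 i = l then p.2.2 l else 0)
      else p.1 i := by
    funext p
    rw [assign_apply]
    split_ifs with h
    · rw [Finset.sum_eq_single ⟨rank p.1 i, h⟩]
      · simp
      · intro l _ hl
        rw [if_neg]
        intro h'
        exact hl (Fin.ext h'.symm)
      · simp
    · rfl
  rw [this]
  have hr : Measurable fun p : (Fin s → ℝ) × ℝ × (Fin k → ℝ) => rank p.1 i :=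
    (measurable_rank i).comp measurable_fst
  refine Measurable.ite (hr measurableSet_Iio) ?_ (by fun_prop)
  refine Measurable.add (by fun_prop) (Finset.measurable_sum _ fun l _ => ?_)
  exact Measurable.ite (hr (measurableSet_singleton (l : ℕ))) (by fun_prop) measurable_const

end Rank

/-! ### Domination and the comparison of two systems -/

section Domination

variable {s : ℕ}

/-- `F` is dominated by `F'` above the threshold `a`: once both vectors are sorted, every entry of
`F` is at most the corresponding entry of `F'` or at most `a`. -/
def Dominated (a : ℝ) (F F' : Fin s → ℝ) : Prop :=
  ∀ j, F (Tuple.sort F j) ≤ max (F' (Tuple.sort F' j)) a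

lemma Dominated.of_perm {a : ℝ} {F F' : Fin s → ℝ} (σ σ' : Equiv.Perm (Fin s))
    (h : ∀ j, F (σ j) ≤ max (F' (σ' j)) a) : Dominated a F F' := by
  intro j
  set t := max (F' (Tuple.sort F' j)) a with ht
  have h1 := Tuple.lt_card_le_iff_apply_le_of_monotone (a := t) (j := j) (Tuple.monotone_sort F)
  have h2 := Tuple.lt_card_le_iff_apply_le_of_monotone (a := t) (j := j) (Tuple.monotone_sort F')
  refine h1.1 (lt_of_lt_of_le (h2.2 (le_max_left _ _)) ?_)
  refine Finset.card_le_card_of_injOn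
    (fun i => (Tuple.sort F).symm (σ (σ'.symm (Tuple.sort F' i)))) ?_ ?_
  · intro i hi
    simp only [Finset.coe_filter, Finset.mem_univ, true_and, Set.mem_ofPred_eq,
      Function.comp] at hi ⊢
    rw [Equiv.apply_symm_apply]
    refine (h _).trans (max_le ?_ (le_max_right _ _))
    rwa [Equiv.apply_symm_apply]
  · intro i _ i' _ hii
    simpa using hii

lemma Dominated.of_le {a : ℝ} {F F' : Fin s → ℝ} (h : ∀ j, F j ≤ max (F' j) a) :
    Dominated a F F' := .of_perm 1 1 h

lemma Dominated.orderStat_le {a : ℝ} {F F' : Fin s → ℝ} (h : Dominated a F F') {k : ℕ}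
    (hk : 1 ≤ k) (hks : k ≤ s) : orderStat k F ≤ max (orderStat k F') a := by
  rw [orderStat_eq_sort hk hks, orderStat_eq_sort hk hks]
  exact h _

lemma Dominated.assign {a : ℝ} {F F' : Fin s → ℝ} (h : Dominated a F F') {k : ℕ} {v v' : ℝ}
    (hv : v ≤ v') (q : Fin k → ℝ) : Dominated a (assign F v q) (assign F' v' q) := by
  refine .of_perm (Tuple.sort F) (Tuple.sort F') fun j => ?_
  rw [assign_sort, assign_sort]
  split_ifs with hj
  · exact le_max_of_le_left (by linarith)
  · exact h j

/-- Two systems with the same service times from the jobs `n` and `n'` on: if the second one,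
delayed by `c`, has later arrivals and dominates the first one initially, then it dominates the
first one, and its jobs start later, from then on. The threshold `a` makes idle times before the
next arrival irrelevant. -/
lemma freeTime_dominated {k : ℕ} (hk : 1 ≤ k) (hks : k ≤ s) {A A' : ℕ → ℝ}
    {q q' : ℕ → Fin k → ℝ} {n n' N : ℕ} {a c : ℝ}
    (h0 : Dominated a (freeTime s A q n) (fun i => freeTime s A' q' n' i + c))
    (hq : ∀ i < N, q (n + i) = q' (n' + i)) (hA : ∀ i < N, A (n + i) ≤ A' (n' + i) + c)
    (ha : ∀ i < N, a ≤ A' (n' + i) + c) :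
    ∀ m ≤ N, Dominated a (freeTime s A q (n + m)) (fun i => freeTime s A' q' (n' + m) i + c) := by
  intro m
  induction m with
  | zero => intro _; exact h0
  | succ m ih =>
    intro hm
    have ih := ih (by omega)
    have hv := ih.orderStat_le hk hks
    have e : orderStat k (fun i => freeTime s A' q' (n' + m) i + c) =
        orderStat k (freeTime s A' q' (n' + m)) + c := by
      have := orderStat_sub_const hk hks (freeTime s A' q' (n' + m)) (-c)
      simpa [sub_neg_eq_add] using this
    rw [e] at hv
    have h1 := hA m (by omega)
    have h2 := ha m (by omega)
    have hle : max (A (n + m)) (orderStat k (freeTime s A q (n + m))) ≤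
        max (A' (n' + m)) (orderStat k (freeTime s A' q' (n' + m))) + c := by
      rw [← max_add_add_right]
      refine max_le (h1.trans (le_max_left _ _)) (hv.trans (max_le (le_max_right _ _) ?_))
      exact h2.trans (le_max_left _ _)
    have h3 := ih.assign hle (q (n + m))
    have e2 : (BEM.assign (fun i => freeTime s A' q' (n' + m) i + c)
        (max (A' (n' + m)) (orderStat k (freeTime s A' q' (n' + m))) + c) (q (n + m))) =
        fun i => freeTime s A' q' (n' + (m + 1)) i + c := by
      funext i
      have := assign_sub_const (freeTime s A' q' (n' + m))
        (max (A' (n' + m)) (orderStat k (freeTime s A' q' (n' + m)))) (-c) (q (n + m)) i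
      simp only [sub_neg_eq_add] at this
      rw [this, hq m (by omega)]
      rfl
    rw [e2] at h3
    exact h3

lemma startTime_le_of_dominated {k : ℕ} (hk : 1 ≤ k) (hks : k ≤ s) {A A' : ℕ → ℝ}
    {q q' : ℕ → Fin k → ℝ} {n n' : ℕ} {a c : ℝ}
    (h : Dominated a (freeTime s A q n) (fun i => freeTime s A' q' n' i + c))
    (hA : A n ≤ A' n' + c) (ha : a ≤ A' n' + c) :
    startTime s A q n ≤ startTime s A' q' n' + c := by
  have hv := h.orderStat_le hk hks
  have e : orderStat k (fun i => freeTime s A' q' n' i + c) =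
      orderStat k (freeTime s A' q' n') + c := by
    have := orderStat_sub_const hk hks (freeTime s A' q' n') (-c)
    simpa [sub_neg_eq_add] using this
  rw [e] at hv
  rw [startTime, startTime, ← max_add_add_right]
  refine max_le (hA.trans (le_max_left _ _)) (hv.trans (max_le (le_max_right _ _) ?_))
  exact ha.trans (le_max_left _ _)

lemma freeTime_succ {k : ℕ} (A : ℕ → ℝ) (q : ℕ → Fin k → ℝ) (n : ℕ) :
    freeTime s A q (n + 1) = assign (freeTime s A q n) (startTime s A q n) (q n) := rfl

lemma freeTime_nonneg {k : ℕ} (hk : 1 ≤ k) (hks : k ≤ s) {A : ℕ → ℝ} {q : ℕ → Fin k → ℝ}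
    (hq : ∀ n i, 0 ≤ q n i) (n : ℕ) (i : Fin s) : 0 ≤ freeTime s A q n i := by
  induction n generalizing i with
  | zero => simp [freeTime]
  | succ n ih =>
    rw [freeTime_succ, assign_apply]
    split_ifs
    · refine add_nonneg ?_ (hq _ _)
      obtain ⟨j, hj⟩ := exists_orderStat_eq hk hks (freeTime s A q n)
      exact (ih j).trans (hj ▸ le_max_right _ _)
    · exact ih i

lemma orderStat_freeTime_nonneg {k : ℕ} (hk : 1 ≤ k) (hks : k ≤ s) {A : ℕ → ℝ}
    {q : ℕ → Fin k → ℝ} (hq : ∀ n i, 0 ≤ q n i) (n : ℕ) :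
    0 ≤ orderStat k (freeTime s A q n) := by
  obtain ⟨j, hj⟩ := exists_orderStat_eq hk hks (freeTime s A q n)
  rw [hj]
  exact freeTime_nonneg hk hks hq n j

lemma startTime_zero_eq {k : ℕ} (hk : 1 ≤ k) (hks : k ≤ s)
    {q : ℕ → Fin k → ℝ} (hq : ∀ n i, 0 ≤ q n i) (n : ℕ) :
    startTime s (fun _ => 0) q n = orderStat k (freeTime s (fun _ => 0) q n) :=
  max_eq_right (orderStat_freeTime_nonneg hk hks hq n)

lemma measurable_freeTime {k : ℕ} (hk : 1 ≤ k) (hks : k ≤ s) (n : ℕ) :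
    Measurable fun p : (ℕ → ℝ) × (ℕ → Fin k → ℝ) => freeTime s p.1 p.2 n := by
  induction n with
  | zero => exact measurable_const
  | succ n ih =>
    have h' : Measurable fun p : (ℕ → ℝ) × (ℕ → Fin k → ℝ) => startTime s p.1 p.2 n :=
      Measurable.max (by fun_prop) ((measurable_orderStat hk hks).comp ih)
    have hq : Measurable fun p : (ℕ → ℝ) × (ℕ → Fin k → ℝ) => p.2 n := by fun_prop
    simp only [freeTime_succ]
    exact (measurable_assign (s := s) (k := k)).comp
      (g := fun p : (Fin s → ℝ) × ℝ × (Fin k → ℝ) => assign p.1 p.2.1 p.2.2)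
      (f := fun p : (ℕ → ℝ) × (ℕ → Fin k → ℝ) =>
        (freeTime s p.1 p.2 n, startTime s p.1 p.2 n, p.2 n)) (ih.prodMk (h'.prodMk hq))

lemma measurable_startTime {k : ℕ} (hk : 1 ≤ k) (hks : k ≤ s) (n : ℕ) :
    Measurable fun p : (ℕ → ℝ) × (ℕ → Fin k → ℝ) => startTime s p.1 p.2 n :=
  Measurable.max (by fun_prop) ((measurable_orderStat hk hks).comp (measurable_freeTime hk hks n))

end Domination

/-! ### Exponential variables -/

section Exponential

open scoped ENNReal

variable {μ : ℝ}

lemma expMeasure_Ioi (hμ : 0 < μ) {t : ℝ} (ht : 0 ≤ t) :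
    expMeasure μ (Set.Ioi t) = ENNReal.ofReal (Real.exp (-(μ * t))) := by
  have := isProbabilityMeasure_expMeasure hμ
  have h := cdf_expMeasure_eq hμ t
  rw [if_pos ht, cdf_eq_real] at h
  rw [← Set.compl_Iic, prob_compl_eq_one_sub measurableSet_Iic, ← ofReal_measureReal, h,
    ← ENNReal.ofReal_one, ← ENNReal.ofReal_sub _ (by rw [← h]; exact measureReal_nonneg)]
  congr 1
  ring

lemma nullSingletonClass_expMeasure (μ : ℝ) : NullSingletonClass (expMeasure μ) := by
  unfold expMeasure gammaMeasure
  infer_instance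

lemma expMeasure_Iic_zero (hμ : 0 < μ) : expMeasure μ (Set.Iic 0) = 0 := by
  have := isProbabilityMeasure_expMeasure hμ
  have h := expMeasure_Ioi hμ le_rfl
  simp only [mul_zero, neg_zero, Real.exp_zero, ENNReal.ofReal_one] at h
  rw [← Set.compl_Ioi, prob_compl_eq_zero_iff measurableSet_Ioi, h]

lemma ae_pos_expMeasure (hμ : 0 < μ) : ∀ᵐ x ∂expMeasure μ, 0 < x := by
  have h : {x : ℝ | ¬ 0 < x} = Set.Iic 0 := by ext; simp
  rw [ae_iff, h, expMeasure_Iic_zero hμ]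

/-- The memoryless property: beyond `v ≥ 0`, the overshoot of an exponential variable is again
exponential. -/
lemma map_sub_restrict_expMeasure (hμ : 0 < μ) {v : ℝ} (hv : 0 ≤ v) :
    ((expMeasure μ).restrict (Set.Ioi v)).map (fun x => x - v) =
      expMeasure μ (Set.Ioi v) • expMeasure μ := by
  have := isProbabilityMeasure_expMeasure hμ
  have hna := nullSingletonClass_expMeasure μ
  have hm : Measurable fun x : ℝ => x - v := by fun_prop
  have : IsFiniteMeasure (((expMeasure μ).restrict (Set.Ioi v)).map (fun x => x - v)) := by
    infer_instance
  refine Measure.ext_of_Ici _ _ fun a => ?_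
  rw [Measure.map_apply hm measurableSet_Ici, Measure.restrict_apply (hm measurableSet_Ici),
    Measure.smul_apply, smul_eq_mul]
  have hpre : (fun x : ℝ => x - v) ⁻¹' Set.Ici a = Set.Ici (a + v) := by
    ext x; simp
  rw [hpre]
  rcases le_or_gt 0 a with ha | ha
  · have h1 : expMeasure μ (Set.Ici (a + v) ∩ Set.Ioi v) = expMeasure μ (Set.Ioi (a + v)) := by
      refine measure_congr ?_
      have : Set.Ioi (a + v) = Set.Ioi (a + v) ∩ Set.Ioi v := by
        ext x; simp only [Set.mem_inter_iff, Set.mem_Ioi]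
        exact ⟨fun h => ⟨h, by linarith⟩, fun h => h.1⟩
      rw [this]
      exact Ioi_ae_eq_Ici.symm.inter (ae_eq_refl _)
    rw [h1, measure_congr Ioi_ae_eq_Ici.symm, expMeasure_Ioi hμ (by linarith),
      expMeasure_Ioi hμ hv, expMeasure_Ioi hμ ha, ← ENNReal.ofReal_mul (Real.exp_pos _).le,
      ← Real.exp_add]
    congr 2
    ring
  · have h1 : Set.Ici (a + v) ∩ Set.Ioi v = Set.Ioi v := by
      ext x; simp only [Set.mem_inter_iff, Set.mem_Ioi, Set.mem_Ici]
      exact ⟨fun h => h.2, fun h => ⟨by linarith, h⟩⟩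
    have h2 : expMeasure μ (Set.Ici a) = 1 := by
      have h3 := expMeasure_Ioi hμ le_rfl
      simp only [mul_zero, neg_zero, Real.exp_zero, ENNReal.ofReal_one] at h3
      refine le_antisymm prob_le_one (h3 ▸ measure_mono fun x hx => ?_)
      exact ha.le.trans (le_of_lt hx)
    rw [h1, h2, mul_one]

/-- The memoryless property of independent exponential variables. -/
lemma lintegral_pi_expMeasure_sub {ι : Type*} [Fintype ι] (hμ : 0 < μ) {v : ℝ} (hv : 0 ≤ v)
    {f : (ι → ℝ) → ℝ≥0∞} (hf : Measurable f) :
    ∫⁻ b in {b | ∀ i, v < b i}, f (fun i => b i - v) ∂(Measure.pi fun _ : ι => expMeasure μ) =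
      (Measure.pi fun _ : ι => expMeasure μ) {b | ∀ i, v < b i} *
        ∫⁻ b, f b ∂(Measure.pi fun _ : ι => expMeasure μ) := by
  have := isProbabilityMeasure_expMeasure hμ
  have hset : {b : ι → ℝ | ∀ i, v < b i} = Set.univ.pi fun _ => Set.Ioi v := by
    ext b; simp
  have hm : Measurable fun (b : ι → ℝ) i => b i - v := by fun_prop
  have hmap : ((Measure.pi fun _ : ι => expMeasure μ).restrict {b | ∀ i, v < b i}).map
      (fun b i => b i - v) =
      (Measure.pi fun _ : ι => expMeasure μ) {b | ∀ i, v < b i} •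
        Measure.pi fun _ : ι => expMeasure μ := by
    have h1 : ∀ i : ι, IsFiniteMeasure (expMeasure μ (Set.Ioi v) • expMeasure μ) := fun _ =>
      Measure.smul_finite _ (measure_ne_top _ _)
    trans Measure.pi fun _ : ι => expMeasure μ (Set.Ioi v) • expMeasure μ
    · rw [hset, Measure.restrict_pi_pi]
      simp only [← map_sub_restrict_expMeasure hμ hv]
      rw [← Measure.pi_map_pi]
      fun_prop
    · refine Measure.pi_eq fun B hB => ?_
      rw [hset, Measure.smul_apply, Measure.pi_pi, Measure.pi_pi, smul_eq_mul,
        ← Finset.prod_mul_distrib]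
      rfl
  rw [← lintegral_map hf hm, hmap, lintegral_smul_measure, smul_eq_mul]

end Exponential

/-! ### Residual service times at a job start -/

section Residual

open scoped ENNReal

variable {s k : ℕ}

/-- The vectors whose `k` workers of lowest rank are `τ 0, …, τ (k - 1)`, in this order. -/
def firstRanks (τ : Fin k → Fin s) : Set (Fin s → ℝ) := {x | ∀ l, rank x (τ l) = l}

lemma measurableSet_firstRanks (τ : Fin k → Fin s) : MeasurableSet (firstRanks τ) := by
  have : firstRanks τ = ⋂ l, (fun x => rank x (τ l)) ⁻¹' {(l : ℕ)} := by
    ext x; simp [firstRanks]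
  rw [this]
  exact MeasurableSet.iInter fun l => measurable_rank (τ l) (measurableSet_singleton _)

lemma iUnion_firstRanks (hks : k ≤ s) :
    ⋃ τ : Fin k → Fin s, firstRanks τ = Set.univ := by
  refine Set.eq_univ_of_forall fun x => Set.mem_iUnion.2 ⟨fun l => Tuple.sort x (l.castLE hks), ?_⟩
  intro l
  simp [rank_sort]

lemma pairwise_disjoint_firstRanks :
    Pairwise (Function.onFun Disjoint fun τ : Fin k → Fin s => firstRanks τ) := by
  intro τ τ' h
  refine Set.disjoint_left.2 fun x hx hx' => h ?_
  funext l
  exact rank_injective x ((hx l).trans (hx' l).symm)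

lemma injective_of_mem_firstRanks {τ : Fin k → Fin s} {x : Fin s → ℝ} (hx : x ∈ firstRanks τ) :
    Function.Injective τ := by
  intro l l' h
  apply Fin.ext
  rw [← hx l, ← hx l', h]

lemma le_rank_of_mem_firstRanks {τ : Fin k → Fin s} {x : Fin s → ℝ}
    (hx : x ∈ firstRanks τ) {j : Fin s} (hj : j ∉ Set.range τ) : k ≤ rank x j := by
  by_contra h
  exact hj ⟨⟨rank x j, not_le.1 h⟩, rank_injective x (hx _)⟩

lemma le_of_mem_firstRanks {τ : Fin k → Fin s} {x : Fin s → ℝ} (hx : x ∈ firstRanks τ)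
    {j : Fin s} (hj : j ∉ Set.range τ) (l : Fin k) : x (τ l) ≤ x j :=
  le_of_rank_le (by rw [hx l]; exact l.2.le.trans (le_rank_of_mem_firstRanks hx hj))

/-- Membership in `firstRanks τ` depends only on the entries at the workers `τ l`, as long as all
other entries are strictly above those. -/
lemma mem_firstRanks_of_agree {τ : Fin k → Fin s} {x x' : Fin s → ℝ} (hx : x ∈ firstRanks τ)
    {z : Fin k} (hz : (z : ℕ) = k - 1) (hag : ∀ l, x' (τ l) = x (τ l))
    (h : ∀ j ∉ Set.range τ, x (τ z) < x j) (h' : ∀ j ∉ Set.range τ, x (τ z) < x' j) :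
    x' ∈ firstRanks τ := by
  intro l
  rw [← hx l]
  unfold rank
  congr 1
  ext j
  simp only [Finset.mem_filter, Finset.mem_univ, true_and]
  have hl : x (τ l) ≤ x (τ z) := le_of_rank_le (by rw [hx l, hx z, hz]; omega)
  by_cases hj : j ∈ Set.range τ
  · obtain ⟨l', rfl⟩ := hj
    simp only [lexLT, hag]
  · have h1 := h j hj
    have h2 := h' j hj
    simp only [lexLT, hag]
    constructor
    · rintro (h3 | h3)
      · linarith
      · linarith [h3.1]
    · rintro (h3 | h3)
      · linarith
      · linarith [h3.1]

lemma measurable_orderStat_residual (hk : 1 ≤ k) (hks : k ≤ s) :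
    Measurable fun y : (Fin s → ℝ) × (Fin k → ℝ) => ((orderStat k y.1,
        fun i => assign y.1 (orderStat k y.1) y.2 i - orderStat k y.1) : ℝ × (Fin s → ℝ)) := by
  have hmos : Measurable (orderStat k : (Fin s → ℝ) → ℝ) := measurable_orderStat hk hks
  have h1 : Measurable fun y : (Fin s → ℝ) × (Fin k → ℝ) => orderStat k y.1 := by fun_prop
  have h2 : Measurable fun y : (Fin s → ℝ) × (Fin k → ℝ) => assign y.1 (orderStat k y.1) y.2 :=
    (measurable_assign (s := s) (k := k)).comp
      (g := fun p : (Fin s → ℝ) × ℝ × (Fin k → ℝ) => assign p.1 p.2.1 p.2.2)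
      (f := fun y : (Fin s → ℝ) × (Fin k → ℝ) => (y.1, orderStat k y.1, y.2))
      (measurable_fst.prodMk (h1.prodMk measurable_snd))
  exact h1.prodMk (measurable_pi_iff.2 fun i => ((measurable_pi_apply i).comp h2).sub h1)

variable {μ : ℝ}

/-- The memoryless property for one order of the first `k` completions. -/
lemma setLIntegral_firstRanks (hμ : 0 < μ) (hk : 1 ≤ k) {m : Fin s → Measure ℝ}
    [∀ i, IsProbabilityMeasure (m i)] (h0 : ∀ i, ∀ᵐ x ∂m i, 0 ≤ x) {τ : Fin k → Fin s}
    (hτ : Function.Injective τ) (hexp : ∀ j ∉ Set.range τ, m j = expMeasure μ)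
    {f : ℝ × (Fin s → ℝ) → ℝ≥0∞} (hf : Measurable f) :
    ∫⁻ x in firstRanks τ, ∫⁻ q, f (orderStat k x,
        fun i => assign x (orderStat k x) q i - orderStat k x)
          ∂(Measure.pi fun _ : Fin k => expMeasure μ) ∂Measure.pi m =
      ∫⁻ x in firstRanks τ, ∫⁻ y, f (orderStat k x, y)
          ∂(Measure.pi fun _ : Fin s => expMeasure μ) ∂Measure.pi m := by
  classical
  have hprob := isProbabilityMeasure_expMeasure hμ
  have hna := nullSingletonClass_expMeasure μ
  let p : Fin s → Prop := fun i => i ∈ Set.range τ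
  let e := MeasurableEquiv.piEquivPiSubtypeProd (fun _ : Fin s => ℝ) p
  have hep : ∀ (y : (Subtype p → ℝ) × ({i // ¬ p i} → ℝ)) (i : Fin s) (hi : p i),
      e.symm y i = y.1 ⟨i, hi⟩ := fun y i hi => by
    simp [e, MeasurableEquiv.piEquivPiSubtypeProd, Equiv.piEquivPiSubtypeProd, hi]
  have hen : ∀ (y : (Subtype p → ℝ) × ({i // ¬ p i} → ℝ)) (i : Fin s) (hi : ¬ p i),
      e.symm y i = y.2 ⟨i, hi⟩ := fun y i hi => by
    simp [e, MeasurableEquiv.piEquivPiSubtypeProd, Equiv.piEquivPiSubtypeProd, hi]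
  -- the worker at which the `k`-th smallest value is attained
  let z : Fin k := ⟨k - 1, by omega⟩
  let v : (Subtype p → ℝ) → ℝ := fun a => a ⟨τ z, z, rfl⟩
  have hmn : (fun i : {i // ¬ p i} => m i) = fun _ => expMeasure μ := by
    funext i; exact hexp i i.2
  have hos : ∀ x ∈ firstRanks τ, orderStat k x = x (τ z) := fun x hx =>
    orderStat_eq_of_rank hk (hx z)
  -- both sides, as integrals over the first `k` completions and the remaining entries
  have hsplit : ∀ Φ : (Fin s → ℝ) → ℝ≥0∞, Measurable Φ →
      ∫⁻ x in firstRanks τ, Φ x ∂Measure.pi m =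
        ∫⁻ a, (∫⁻ b, (firstRanks τ).indicator Φ (e.symm (a, b))
          ∂(Measure.pi fun _ : {i // ¬ p i} => expMeasure μ))
          ∂(Measure.pi fun i : Subtype p => m i) := by
    intro Φ hΦ
    have hmp := (measurePreserving_piEquivPiSubtypeProd m p).symm
    rw [← lintegral_indicator (measurableSet_firstRanks τ),
      ← hmp.lintegral_comp (hΦ.indicator (measurableSet_firstRanks τ)), hmn]
    convert lintegral_prod (μ := Measure.pi fun i : Subtype p => m i)
      (ν := Measure.pi fun _ : {i // ¬ p i} => expMeasure μ)
      (fun y => (firstRanks τ).indicator Φ (e.symm y))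
      ((hΦ.indicator (measurableSet_firstRanks τ)).comp e.symm.measurable).aemeasurable
  have hinner : ∀ (Φ : (Fin s → ℝ) → ℝ≥0∞) (a : Subtype p → ℝ),
      ∫⁻ b, (firstRanks τ).indicator Φ (e.symm (a, b))
          ∂(Measure.pi fun _ : {i // ¬ p i} => expMeasure μ) =
        if e.symm (a, fun _ => v a + 1) ∈ firstRanks τ then
          ∫⁻ b in {b | ∀ i, v a < b i}, Φ (e.symm (a, b))
            ∂(Measure.pi fun _ : {i // ¬ p i} => expMeasure μ)
        else 0 := by
    intro Φ a
    have hmeas : MeasurableSet {b : {i // ¬ p i} → ℝ | ∀ i, v a < b i} := by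
      have : {b : {i // ¬ p i} → ℝ | ∀ i, v a < b i} = Set.univ.pi fun _ => Set.Ioi (v a) := by
        ext b; simp
      rw [this]
      exact MeasurableSet.univ_pi fun _ => measurableSet_Ioi
    have hagree : ∀ b b' : {i // ¬ p i} → ℝ, (∀ i, v a < b i) → (∀ i, v a < b' i) →
        e.symm (a, b) ∈ firstRanks τ → e.symm (a, b') ∈ firstRanks τ := by
      intro b b' hb hb' hx
      refine mem_firstRanks_of_agree hx (z := z) rfl (fun l => ?_) (fun j hj => ?_) (fun j hj => ?_)
      · rw [hep _ _ ⟨l, rfl⟩, hep _ _ ⟨l, rfl⟩]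
      · rw [hep _ _ ⟨z, rfl⟩, hen _ _ hj]; exact hb _
      · rw [hep _ _ ⟨z, rfl⟩, hen _ _ hj]; exact hb' _
    have hne : ∀ᵐ b ∂(Measure.pi fun _ : {i // ¬ p i} => expMeasure μ), ∀ i, b i ≠ v a :=
      ae_all_iff.2 fun i => by
        rw [ae_iff]
        simpa using Measure.pi_hyperplane (fun _ : {i // ¬ p i} => expMeasure μ) i (v a)
    rw [← lintegral_indicator hmeas]
    split_ifs with hc
    · refine lintegral_congr_ae (hne.mono fun b hb => ?_)
      by_cases hbv : ∀ i, v a < b i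
      · have h1 : e.symm (a, b) ∈ firstRanks τ :=
          hagree _ b (fun _ => by simp) hbv hc
        exact (Set.indicator_of_mem h1 Φ).trans
          (Set.indicator_of_mem (s := {b | ∀ i, v a < b i}) (by exact hbv)
            (fun b => Φ (e.symm (a, b)))).symm
      · refine (Set.indicator_of_notMem (fun h1 => hbv fun i => ?_) Φ).trans
          (Set.indicator_of_notMem (s := {b | ∀ i, v a < b i}) (by exact hbv)
            (fun b => Φ (e.symm (a, b)))).symm
        refine lt_of_le_of_ne ?_ (hb i).symm
        have h2 := le_of_mem_firstRanks h1 i.2 z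
        rwa [hep _ _ ⟨z, rfl⟩, hen _ _ i.2] at h2
    · rw [← lintegral_zero (μ := Measure.pi fun _ : {i // ¬ p i} => expMeasure μ)]
      refine lintegral_congr_ae (hne.mono fun b hb => ?_)
      refine Set.indicator_of_notMem (fun h1 => hc ?_) _
      refine hagree b _ (fun i => ?_) (fun _ => by simp) h1
      refine lt_of_le_of_ne ?_ (hb i).symm
      have h2 := le_of_mem_firstRanks h1 i.2 z
      rwa [hep _ _ ⟨z, rfl⟩, hen _ _ i.2] at h2
  have hvnn : ∀ᵐ a ∂(Measure.pi fun i : Subtype p => m i), 0 ≤ v a :=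
    (measurePreserving_eval (fun i : Subtype p => m i) ⟨τ z, z, rfl⟩).quasiMeasurePreserving.ae
      (h0 (τ z))
  have hks : k ≤ s := by simpa using Fintype.card_le_of_injective τ hτ
  have hmos : Measurable (orderStat k : (Fin s → ℝ) → ℝ) := measurable_orderStat hk hks
  have hmas : Measurable fun y : (Fin s → ℝ) × (Fin k → ℝ) => f (orderStat k y.1,
        fun i => assign y.1 (orderStat k y.1) y.2 i - orderStat k y.1) :=
    hf.comp (measurable_orderStat_residual hk hks)
  refine (hsplit _ hmas.lintegral_prod_right').trans (Eq.trans ?_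
    (hsplit _ (hf.lintegral_prod_right'.comp hmos)).symm)
  refine lintegral_congr_ae (hvnn.mono fun a ha => ?_)
  simp only [hinner]
  by_cases hc : e.symm (a, fun _ => v a + 1) ∈ firstRanks τ
  swap
  · rw [if_neg hc, if_neg hc]
  rw [if_pos hc, if_pos hc]
  have hmem : ∀ b : {i // ¬ p i} → ℝ, (∀ i, v a < b i) → e.symm (a, b) ∈ firstRanks τ := by
    intro b hb
    refine mem_firstRanks_of_agree hc (z := z) rfl (fun l => ?_) (fun j hj => ?_) (fun j hj => ?_)
    · rw [hep _ _ ⟨l, rfl⟩, hep _ _ ⟨l, rfl⟩]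
    · rw [hep _ _ ⟨z, rfl⟩, hen _ _ hj]; exact lt_add_one _
    · rw [hep _ _ ⟨z, rfl⟩, hen _ _ hj]; exact hb _
  have hmeas : MeasurableSet {b : {i // ¬ p i} → ℝ | ∀ i, v a < b i} := by
    have : {b : {i // ¬ p i} → ℝ | ∀ i, v a < b i} = Set.univ.pi fun _ => Set.Ioi (v a) := by
      ext b; simp
    rw [this]
    exact MeasurableSet.univ_pi fun _ => measurableSet_Ioi
  have hosb : ∀ b : {i // ¬ p i} → ℝ, (∀ i, v a < b i) → orderStat k (e.symm (a, b)) = v a := by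
    intro b hb
    rw [hos _ (hmem b hb), hep _ _ ⟨z, rfl⟩]
  -- the fresh tasks, placed at the workers `τ l`
  let r : (Fin k → ℝ) ≃ᵐ (Subtype p → ℝ) :=
    MeasurableEquiv.piCongrLeft (fun _ : Subtype p => ℝ) (Equiv.ofInjective τ hτ)
  have hr : ∀ (q : Fin k → ℝ) (l : Fin k), r q ⟨τ l, l, rfl⟩ = q l := fun q l =>
    Equiv.piCongrLeft_apply_apply (fun _ : Subtype p => ℝ) (Equiv.ofInjective τ hτ) q l
  let h : ({i // ¬ p i} → ℝ) → ℝ≥0∞ := fun b =>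
    ∫⁻ q, f (v a, e.symm (r q, b)) ∂(Measure.pi fun _ : Fin k => expMeasure μ)
  have hhm : Measurable fun y : ({i // ¬ p i} → ℝ) × (Fin k → ℝ) =>
      f (v a, e.symm (r y.2, y.1)) :=
    hf.comp (measurable_const.prodMk (e.symm.measurable.comp
      ((r.measurable.comp measurable_snd).prodMk measurable_fst)))
  have hleft : ∫⁻ b in {b | ∀ i, v a < b i}, ∫⁻ q, f (orderStat k (e.symm (a, b)),
        fun i => assign (e.symm (a, b)) (orderStat k (e.symm (a, b))) q i -
          orderStat k (e.symm (a, b))) ∂(Measure.pi fun _ : Fin k => expMeasure μ)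
        ∂(Measure.pi fun _ : {i // ¬ p i} => expMeasure μ) =
      ∫⁻ b in {b | ∀ i, v a < b i}, h (fun i => b i - v a)
        ∂(Measure.pi fun _ : {i // ¬ p i} => expMeasure μ) := by
    refine setLIntegral_congr_fun hmeas fun b hb => ?_
    refine lintegral_congr fun q => ?_
    simp only [hosb b hb]
    congr 2
    funext i
    have hx := hmem b hb
    rw [assign_apply]
    by_cases hi : p i
    · obtain ⟨l, rfl⟩ := hi
      have hl : rank (e.symm (a, b)) (τ l) = l := hx l
      rw [dif_pos (by rw [hl]; exact l.2), hep _ _ ⟨l, rfl⟩]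
      refine Eq.trans ?_ (hr q l).symm
      simp [hl]
    · rw [dif_neg (not_lt.2 (le_rank_of_mem_firstRanks hx hi)), hen _ _ hi, hen _ _ hi]
  have hright : ∫⁻ y, f (v a, y) ∂(Measure.pi fun _ : Fin s => expMeasure μ) =
      ∫⁻ b, h b ∂(Measure.pi fun _ : {i // ¬ p i} => expMeasure μ) := by
    have hmp := (measurePreserving_piEquivPiSubtypeProd (fun _ : Fin s => expMeasure μ) p).symm
    have hfv : Measurable fun y => f (v a, y) := hf.comp measurable_prodMk_left
    rw [← hmp.lintegral_comp hfv]
    refine (lintegral_prod_symm (fun y => f (v a, e.symm y))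
      (hfv.comp e.symm.measurable).aemeasurable).trans (lintegral_congr fun b => ?_)
    have hmr : MeasurePreserving r (Measure.pi fun _ : Fin k => expMeasure μ)
        (Measure.pi fun _ : Subtype p => expMeasure μ) :=
      measurePreserving_piCongrLeft (fun _ : Subtype p => expMeasure μ) (Equiv.ofInjective τ hτ)
    convert (hmr.lintegral_comp (f := fun a' => f (v a, e.symm (a', b)))
      (hfv.comp (e.symm.measurable.comp measurable_prodMk_right))).symm
  have hright' : ∫⁻ b in {b | ∀ i, v a < b i}, (∫⁻ y, f (orderStat k (e.symm (a, b)), y)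
        ∂(Measure.pi fun _ : Fin s => expMeasure μ))
        ∂(Measure.pi fun _ : {i // ¬ p i} => expMeasure μ) =
      ∫⁻ b in {b | ∀ i, v a < b i}, (∫⁻ y, f (v a, y)
        ∂(Measure.pi fun _ : Fin s => expMeasure μ))
        ∂(Measure.pi fun _ : {i // ¬ p i} => expMeasure μ) :=
    setLIntegral_congr_fun hmeas fun b hb => by simp only [hosb b hb]
  have hhm' : Measurable h := hhm.lintegral_prod_right'
  refine hleft.trans (Eq.trans ?_ hright'.symm)
  rw [lintegral_pi_expMeasure_sub hμ ha hhm', hright, lintegral_const,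
    Measure.restrict_apply_univ, mul_comm]

/-- If the workers become free at independent times `X i`, exponential for all workers that are not
among the first `k`, then `k` new exponential tasks started at the `k`-th smallest of these times
leave `s` independent exponential residual times, independent of the starting time. -/
theorem map_orderStat_residual (hμ : 0 < μ) (hk : 1 ≤ k) (hks : k ≤ s) {m : Fin s → Measure ℝ}
    [∀ i, IsProbabilityMeasure (m i)] (h0 : ∀ i, ∀ᵐ x ∂m i, 0 ≤ x)
    (hexp : ∀ᵐ x ∂Measure.pi m, ∀ j, k ≤ rank x j → m j = expMeasure μ) :
    ((Measure.pi m).prod (Measure.pi fun _ : Fin k => expMeasure μ)).map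
        (fun y => (orderStat k y.1,
          fun i => assign y.1 (orderStat k y.1) y.2 i - orderStat k y.1)) =
      ((Measure.pi m).map (orderStat k)).prod (Measure.pi fun _ : Fin s => expMeasure μ) := by
  have hprob := isProbabilityMeasure_expMeasure hμ
  have hmos : Measurable (orderStat k : (Fin s → ℝ) → ℝ) := measurable_orderStat hk hks
  have hmas := measurable_orderStat_residual (s := s) hk hks
  refine Measure.ext_of_lintegral _ fun f hf => ?_
  rw [lintegral_map hf hmas, lintegral_prod _ hf.aemeasurable,
    lintegral_map hf.lintegral_prod_right' hmos]
  refine (lintegral_prod _ (hf.comp hmas).aemeasurable).trans ?_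
  have hpart : ∀ Φ : (Fin s → ℝ) → ℝ≥0∞, ∫⁻ x, Φ x ∂Measure.pi m =
      ∑' τ : Fin k → Fin s, ∫⁻ x in firstRanks τ, Φ x ∂Measure.pi m := fun Φ => by
    rw [← lintegral_iUnion measurableSet_firstRanks pairwise_disjoint_firstRanks,
      iUnion_firstRanks hks, Measure.restrict_univ]
  rw [hpart, hpart]
  congr 1
  funext τ
  by_cases hnull : Measure.pi m (firstRanks τ) = 0
  · rw [setLIntegral_measure_zero _ _ hnull, setLIntegral_measure_zero _ _ hnull]
  · obtain ⟨x, hx, hxe⟩ : ∃ x ∈ firstRanks τ, ∀ j, k ≤ rank x j → m j = expMeasure μ := by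
      by_contra hcon
      push Not at hcon
      apply hnull
      refine measure_mono_null (fun x hx => ?_) (ae_iff.1 hexp)
      obtain ⟨j, hj1, hj2⟩ := hcon x hx
      exact fun h => hj2 (h j hj1)
    exact setLIntegral_firstRanks hμ hk h0 (injective_of_mem_firstRanks hx)
      (fun j hj => hxe j (le_rank_of_mem_firstRanks hx hj)) hf

end Residual

/-! ### The mean of an exponential order statistic -/

section Mean

variable {μ : ℝ}

lemma memLp_two_id_expMeasure (hμ : 0 < μ) : MemLp (id : ℝ → ℝ) 2 (expMeasure μ) := by
  rw [memLp_two_iff_integrable_sq aestronglyMeasurable_id]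
  have hd : expMeasure μ = volume.withDensity (exponentialPDF μ) := rfl
  rw [hd, integrable_withDensity_iff
    (f := exponentialPDF μ) (measurable_exponentialPDFReal μ).ennreal_ofReal
    (by simp [exponentialPDF])]
  have h : IntegrableOn (fun x : ℝ => μ * (x ^ (2 : ℝ) * Real.exp (-μ * x ^ (1 : ℝ))))
      (Set.Ioi 0) :=
    (integrableOn_rpow_mul_exp_neg_mul_rpow (by norm_num) zero_lt_one hμ).const_mul μ
  rw [← integrable_indicator_iff measurableSet_Ioi] at h
  refine h.congr (.of_forall fun x => ?_)
  simp only [Set.indicator, Set.mem_Ioi, exponentialPDF_eq, id, Real.rpow_one, Real.rpow_ofNat]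
  rcases lt_trichotomy x 0 with hx | rfl | hx
  · simp [hx.not_gt, hx.not_ge]
  · simp
  · rw [if_pos hx, if_pos hx.le, ENNReal.toReal_ofReal (by positivity)]
    ring_nf

lemma orderStat_nonneg {s k : ℕ} (hk : 1 ≤ k) (hks : k ≤ s) {x : Fin s → ℝ} (hx : ∀ i, 0 ≤ x i) :
    0 ≤ orderStat k x := by
  obtain ⟨i, hi⟩ := exists_orderStat_eq hk hks x
  rw [hi]; exact hx i

lemma memLp_two_eval_pi_expMeasure (hμ : 0 < μ) {s : ℕ} (i : Fin s) :
    MemLp (fun x : Fin s → ℝ => x i) 2 (Measure.pi fun _ => expMeasure μ) := by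
  have := isProbabilityMeasure_expMeasure hμ
  exact (memLp_two_id_expMeasure hμ).comp_measurePreserving
    (measurePreserving_eval (fun _ : Fin s => expMeasure μ) i)

lemma ae_pos_pi_expMeasure (hμ : 0 < μ) (s : ℕ) :
    ∀ᵐ x ∂(Measure.pi fun _ : Fin s => expMeasure μ), ∀ i, 0 < x i := by
  have := isProbabilityMeasure_expMeasure hμ
  exact ae_all_iff.2 fun i => (measurePreserving_eval (fun _ : Fin s => expMeasure μ)
    i).quasiMeasurePreserving.ae (ae_pos_expMeasure hμ)

lemma memLp_two_orderStat (hμ : 0 < μ) {s k : ℕ} (hk : 1 ≤ k) (hks : k ≤ s) :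
    MemLp (orderStat k) 2 (Measure.pi fun _ : Fin s => expMeasure μ) := by
  have h : MemLp (fun x : Fin s → ℝ => ∑ i, x i) 2 (Measure.pi fun _ => expMeasure μ) :=
    memLp_finsetSum _ fun i _ => memLp_two_eval_pi_expMeasure hμ i
  refine h.mono (measurable_orderStat hk hks).aestronglyMeasurable ?_
  filter_upwards [ae_pos_pi_expMeasure hμ s] with x hx
  rw [Real.norm_of_nonneg (orderStat_nonneg hk hks fun i => (hx i).le),
    Real.norm_of_nonneg (Finset.sum_nonneg fun i _ => (hx i).le)]
  obtain ⟨i, hi⟩ := exists_orderStat_eq hk hks x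
  rw [hi]
  exact Finset.single_le_sum (fun j _ => (hx j).le) (Finset.mem_univ i)

/-- The number of variables below `t` is binomial. -/
lemma measureReal_lt_orderStat (hμ : 0 < μ) {s k : ℕ} (hk : 1 ≤ k) (hks : k ≤ s) {t : ℝ}
    (ht : 0 ≤ t) :
    (Measure.pi fun _ : Fin s => expMeasure μ).real {x | t < orderStat k x} =
      ∑ j ∈ Finset.range k, (s.choose j : ℝ) *
        ((1 - Real.exp (-(μ * t))) ^ j * Real.exp (-(μ * t)) ^ (s - j)) := by
  classical
  have := isProbabilityMeasure_expMeasure hμ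
  have h1 : (expMeasure μ).real (Set.Ioi t) = Real.exp (-(μ * t)) := by
    rw [measureReal_def, expMeasure_Ioi hμ ht, ENNReal.toReal_ofReal (Real.exp_pos _).le]
  have h2 : (expMeasure μ).real (Set.Iic t) = 1 - Real.exp (-(μ * t)) := by
    rw [← h1, ← Set.compl_Ioi, probReal_compl_eq_one_sub measurableSet_Ioi]
  let box : Finset (Fin s) → Set (Fin s → ℝ) := fun A =>
    Set.univ.pi fun i => if i ∈ A then Set.Iic t else Set.Ioi t
  have hbox : ∀ A x, x ∈ box A ↔ (Finset.univ.filter fun i => x i ≤ t) = A := by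
    intro A x
    simp only [box, Set.mem_univ_pi, Finset.ext_iff, Finset.mem_filter, Finset.mem_univ, true_and]
    refine forall_congr' fun i => ?_
    split_ifs with hi <;> simp [hi]
  have hboxm : ∀ A, (Measure.pi fun _ : Fin s => expMeasure μ).real (box A) =
      (1 - Real.exp (-(μ * t))) ^ A.card * Real.exp (-(μ * t)) ^ (s - A.card) := by
    intro A
    rw [measureReal_def, Measure.pi_pi, ENNReal.toReal_prod]
    have : ∀ i, (expMeasure μ (if i ∈ A then Set.Iic t else Set.Ioi t)).toReal =
        if i ∈ A then 1 - Real.exp (-(μ * t)) else Real.exp (-(μ * t)) := by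
      intro i
      split_ifs
      · exact h2
      · exact h1
    simp only [this]
    rw [Finset.prod_ite, Finset.prod_const, Finset.prod_const]
    congr 2
    · simp
    · rw [← Finset.compl_filter, Finset.card_compl]
      simp
  have hset : {x : Fin s → ℝ | t < orderStat k x} =
      ⋃ A ∈ Finset.univ.filter fun A : Finset (Fin s) => A.card < k, box A := by
    ext x
    simp only [Set.mem_ofPred_eq, Set.mem_iUnion, Finset.mem_filter, Finset.mem_univ, true_and,
      hbox, exists_prop, lt_orderStat_iff hk hks]
    simp
  rw [hset, measureReal_biUnion_finset]
  · simp only [hboxm]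
    rw [← Finset.sum_fiberwise_of_maps_to (t := Finset.range k) (g := Finset.card)
      (fun A hA => by simpa using hA)]
    refine Finset.sum_congr rfl fun j hj => ?_
    have : ((Finset.univ.filter fun A : Finset (Fin s) => A.card < k).filter
        fun A => A.card = j) = Finset.powersetCard j Finset.univ := by
      ext A
      simp only [Finset.mem_filter, Finset.mem_univ, true_and, Finset.mem_powersetCard,
        Finset.subset_univ]
      rw [Finset.mem_range] at hj
      constructor
      · exact fun h => h.2
      · rintro rfl; exact ⟨hj, rfl⟩
    rw [this, Finset.sum_congr rfl (g := fun _ =>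
      (1 - Real.exp (-(μ * t))) ^ j * Real.exp (-(μ * t)) ^ (s - j))]
    · simp
    · intro A hA
      rw [(Finset.mem_powersetCard.1 hA).2]
  · intro A _ B _ hAB
    refine Set.disjoint_left.2 fun x hx hx' => hAB ?_
    rw [← (hbox A x).1 hx, (hbox B x).1 hx']
  · intro A _
    refine MeasurableSet.univ_pi fun i => ?_
    split_ifs
    · exact measurableSet_Iic
    · exact measurableSet_Ioi

lemma integrableOn_one_sub_exp_pow_mul (hμ : 0 < μ) {s j : ℕ} (hj : j < s) :
    IntegrableOn (fun t => (1 - Real.exp (-(μ * t))) ^ j * Real.exp (-(μ * t)) ^ (s - j))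
      (Set.Ioi 0) := by
  have h := exp_neg_integrableOn_Ioi 0 hμ
  simp only [neg_mul] at h
  refine h.mono' (Continuous.aestronglyMeasurable (by fun_prop)) ?_
  filter_upwards [ae_restrict_mem measurableSet_Ioi] with t ht
  have h1 : Real.exp (-(μ * t)) ≤ 1 := Real.exp_le_one_iff.2 (by
    have := mul_pos hμ (Set.mem_Ioi.1 ht); linarith)
  have h0 := (Real.exp_pos (-(μ * t)))
  rw [Real.norm_of_nonneg (mul_nonneg (pow_nonneg (by linarith) _) (pow_nonneg h0.le _))]
  calc _ ≤ 1 * Real.exp (-(μ * t)) ^ 1 := by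
        refine mul_le_mul (pow_le_one₀ (by linarith) (by linarith)) ?_ (by positivity) zero_le_one
        exact pow_le_pow_of_le_one h0.le h1 (by omega)
    _ = _ := by ring

lemma integral_one_sub_exp_pow_mul (hμ : 0 < μ) {s j : ℕ} (hj : j < s) :
    (s.choose j : ℝ) * ∫ t in Set.Ioi 0,
      (1 - Real.exp (-(μ * t))) ^ j * Real.exp (-(μ * t)) ^ (s - j) = 1 / (μ * (s - j)) := by
  induction j with
  | zero =>
    have hs : (0 : ℝ) < s := by exact_mod_cast hj
    have h : ∀ t, Real.exp (-(μ * t)) ^ s = Real.exp (-(μ * s) * t) := fun t => by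
      rw [← Real.exp_nat_mul]; congr 1; ring
    simp only [Nat.choose_zero_right, Nat.cast_one, pow_zero, one_mul, Nat.sub_zero, h,
      Nat.cast_zero, sub_zero]
    rw [integral_exp_mul_Ioi (by have := mul_pos hμ hs; linarith)]
    simp [neg_div, div_neg]
  | succ j ih =>
    have ih := ih (by omega)
    have hint0 := integrableOn_one_sub_exp_pow_mul hμ (s := s) (j := j) (by omega)
    have hint1 := integrableOn_one_sub_exp_pow_mul hμ (s := s) (j := j + 1) hj
    -- the derivative of `(1 - u) ^ (j + 1) * u ^ (s - (j + 1))` at `u = exp (-μ t)` relates the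
    -- integrals for `j` and `j + 1`
    have hd : ∀ t : ℝ, HasDerivAt
        (fun t => (1 - Real.exp (-(μ * t))) ^ (j + 1) * Real.exp (-(μ * t)) ^ (s - (j + 1)))
        (μ * (j + 1) * ((1 - Real.exp (-(μ * t))) ^ j * Real.exp (-(μ * t)) ^ (s - j)) -
          μ * (s - (j + 1)) * ((1 - Real.exp (-(μ * t))) ^ (j + 1) *
            Real.exp (-(μ * t)) ^ (s - (j + 1)))) t := by
      intro t
      have he : HasDerivAt (fun t => Real.exp (-(μ * t))) (-μ * Real.exp (-(μ * t))) t := by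
        have := ((hasDerivAt_id t).const_mul (-μ)).exp
        simp only [id, mul_one, neg_mul] at this
        convert this using 1
        ring
      have h := ((he.const_sub 1).pow (j + 1)).mul (he.pow (s - (j + 1)))
      refine h.congr_deriv ?_
      obtain ⟨r, rfl⟩ : ∃ r, s = r + (j + 1) + 1 := ⟨s - (j + 1) - 1, by omega⟩
      have e1 : r + (j + 1) + 1 - (j + 1) = r + 1 := by omega
      have e2 : r + (j + 1) + 1 - j = r + 2 := by omega
      simp only [e1, e2, Nat.add_sub_cancel, Pi.pow_apply]
      push_cast
      ring
    have hlim : Tendsto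
        (fun t => (1 - Real.exp (-(μ * t))) ^ (j + 1) * Real.exp (-(μ * t)) ^ (s - (j + 1)))
        atTop (𝓝 0) := by
      have hu : Tendsto (fun t => Real.exp (-(μ * t))) atTop (𝓝 0) :=
        Real.tendsto_exp_neg_atTop_nhds_zero.comp (tendsto_id.const_mul_atTop hμ)
      have := ((hu.const_sub 1).pow (j + 1)).mul (hu.pow (s - (j + 1)))
      rwa [zero_pow (by omega), mul_zero] at this
    have hI := integral_Ioi_of_hasDerivAt_of_tendsto (a := 0) (hd 0).continuousAt.continuousWithinAt
      (fun t _ => hd t) ((hint0.const_mul _).sub (hint1.const_mul _)) hlim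
    rw [integral_sub (hint0.const_mul _) (hint1.const_mul _), integral_const_mul,
      integral_const_mul] at hI
    simp only [mul_zero, neg_zero, Real.exp_zero, sub_self, ne_eq, Nat.add_eq_zero_iff, one_ne_zero,
      and_false, not_false_eq_true, zero_pow, zero_mul] at hI
    have hc : (s.choose (j + 1) : ℝ) * (j + 1) = s.choose j * (s - j) := by
      have := Nat.choose_succ_right_eq s j
      rw [← Nat.cast_sub (by omega : j ≤ s)]
      exact_mod_cast this
    have hs1 : (0 : ℝ) < s - (j + 1) := by
      have : ((j + 1 : ℕ) : ℝ) < s := by exact_mod_cast hj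
      push_cast at this; linarith
    have hs2 : (0 : ℝ) < s - j := by linarith
    push_cast
    rw [eq_div_iff (by positivity)] at ih ⊢
    set J0 := ∫ t in Set.Ioi 0, (1 - Real.exp (-(μ * t))) ^ j * Real.exp (-(μ * t)) ^ (s - j)
    set J1 := ∫ t in Set.Ioi 0,
      (1 - Real.exp (-(μ * t))) ^ (j + 1) * Real.exp (-(μ * t)) ^ (s - (j + 1))
    have hI' : μ * (s - (j + 1)) * J1 = μ * (j + 1) * J0 := by linarith
    calc (s.choose (j + 1) : ℝ) * J1 * (μ * (s - (j + 1)))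
        = s.choose (j + 1) * (μ * (s - (j + 1)) * J1) := by ring
      _ = (s.choose (j + 1) * (j + 1)) * (μ * J0) := by rw [hI']; ring
      _ = s.choose j * J0 * (μ * (s - j)) := by rw [hc]; ring
      _ = 1 := ih

lemma harmonic_sub_harmonic {s k : ℕ} (hks : k ≤ s) :
    (harmonic s : ℝ) - (harmonic (s - k) : ℝ) = ∑ j ∈ Finset.range k, 1 / ((s : ℝ) - j) := by
  induction k with
  | zero => simp
  | succ k ih =>
    have ih := ih (by omega)
    rw [Finset.sum_range_succ, ← ih]
    have h : s - k = (s - (k + 1)) + 1 := by omega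
    have hs : (((s - (k + 1) : ℕ) : ℝ) + 1) = s - k := by
      have : ((s - (k + 1) + 1 : ℕ) : ℝ) = ((s - k : ℕ) : ℝ) := by rw [← h]
      rw [Nat.cast_sub (by omega : k ≤ s)] at this
      exact_mod_cast this
    rw [h, harmonic_succ]
    push_cast
    rw [hs]
    ring

lemma integral_orderStat (hμ : 0 < μ) {s k : ℕ} (hk : 1 ≤ k) (hks : k ≤ s) :
    ∫ x, orderStat k x ∂(Measure.pi fun _ : Fin s => expMeasure μ) =
      ((harmonic s : ℝ) - (harmonic (s - k) : ℝ)) / μ := by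
  have := isProbabilityMeasure_expMeasure hμ
  have hint := (memLp_two_orderStat hμ hk hks).integrable one_le_two
  rw [hint.integral_eq_integral_meas_lt ((ae_pos_pi_expMeasure hμ s).mono fun x hx =>
    orderStat_nonneg hk hks fun i => (hx i).le)]
  rw [setIntegral_congr_fun measurableSet_Ioi fun t ht =>
    measureReal_lt_orderStat hμ hk hks (le_of_lt (Set.mem_Ioi.1 ht))]
  rw [integral_finsetSum _ fun j hj => (integrableOn_one_sub_exp_pow_mul hμ
    ((Finset.mem_range.1 hj).trans_le hks)).const_mul _]
  rw [harmonic_sub_harmonic hks, Finset.sum_div]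
  refine Finset.sum_congr rfl fun j hj => ?_
  rw [integral_const_mul, integral_one_sub_exp_pow_mul hμ ((Finset.mem_range.1 hj).trans_le hks)]
  rw [div_div, mul_comm]

lemma integral_id_expMeasure (hμ : 0 < μ) : ∫ x, x ∂expMeasure μ = 1 / μ := by
  have := isProbabilityMeasure_expMeasure hμ
  have h := integral_orderStat hμ (s := 1) (k := 1) le_rfl le_rfl
  have hos : ∀ x : Fin 1 → ℝ, orderStat 1 x = x 0 := fun x => by
    obtain ⟨i, hi⟩ := exists_orderStat_eq le_rfl le_rfl x
    rw [hi, Subsingleton.elim i 0]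
  simp only [hos] at h
  have h2 := (measurePreserving_eval (fun _ : Fin 1 => expMeasure μ) 0).map_eq
  rw [← h2, integral_map (measurable_pi_apply 0).aemeasurable (by fun_prop)]
  simpa using h

/-! ### The maximum stable utilization -/

lemma harmonic_sub_harmonic_pos {s k : ℕ} (hk : 1 ≤ k) (hks : k ≤ s) :
    0 < (harmonic s : ℝ) - (harmonic (s - k) : ℝ) := by
  rw [harmonic_sub_harmonic hks]
  refine Finset.sum_pos (fun j hj => ?_) ⟨0, Finset.mem_range.2 hk⟩
  have : (j : ℝ) < s := by exact_mod_cast (Finset.mem_range.1 hj).trans_le hks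
  exact one_div_pos.2 (by linarith)

lemma maxUtilization_eq {s k : ℕ} (hk : 1 ≤ k) (hks : k ≤ s) :
    maxUtilization s k =
      1 / ∑ j ∈ Finset.range k, 1 / ((k : ℝ) - (j : ℝ) * ((k : ℝ) / (s : ℝ))) := by
  have hk0 : (0 : ℝ) < k := by exact_mod_cast hk
  have hs0 : (0 : ℝ) < s := by exact_mod_cast hk.trans hks
  have h : ∀ j ∈ Finset.range k, 1 / ((k : ℝ) - (j : ℝ) * ((k : ℝ) / (s : ℝ))) =
      s / k * (1 / ((s : ℝ) - j)) := by
    intro j hj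
    have : (j : ℝ) < s := by exact_mod_cast (Finset.mem_range.1 hj).trans_le hks
    have h1 : (s : ℝ) - j ≠ 0 := by linarith
    have h2 : (k : ℝ) - j * (k / s) = k / s * (s - j) := by field_simp
    rw [h2]
    field_simp
  rw [Finset.sum_congr rfl h, ← Finset.mul_sum, ← harmonic_sub_harmonic hks, maxUtilization]
  have := harmonic_sub_harmonic_pos hk hks
  field_simp

lemma maxUtilization_le_one {s k : ℕ} (hk : 1 ≤ k) (hks : k ≤ s) : maxUtilization s k ≤ 1 := by
  have hs0 : (0 : ℝ) < s := by exact_mod_cast hk.trans hks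
  rw [maxUtilization, div_le_one (mul_pos hs0 (harmonic_sub_harmonic_pos hk hks)),
    harmonic_sub_harmonic hks, Finset.mul_sum]
  calc (k : ℝ) = ∑ j ∈ Finset.range k, (1 : ℝ) := by simp
    _ ≤ _ := Finset.sum_le_sum fun j hj => by
        have : (j : ℝ) < s := by exact_mod_cast (Finset.mem_range.1 hj).trans_le hks
        rw [mul_one_div, le_div_iff₀ (by linarith)]
        have : (0 : ℝ) ≤ j := by positivity
        linarith

lemma one_sub_le_maxUtilization {s k : ℕ} (hk : 1 ≤ k) (hks : k ≤ s) :
    1 - (k : ℝ) / s ≤ maxUtilization s k := by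
  have hs0 : (0 : ℝ) < s := by exact_mod_cast hk.trans hks
  have hks' : (k : ℝ) ≤ s := by exact_mod_cast hks
  have hpos := harmonic_sub_harmonic_pos hk hks
  rw [maxUtilization, le_div_iff₀ (mul_pos hs0 hpos)]
  have h1 : (1 - (k : ℝ) / s) * (s * ((harmonic s : ℝ) - (harmonic (s - k) : ℝ))) =
      ∑ j ∈ Finset.range k, (s - k) * (1 / ((s : ℝ) - j)) := by
    rw [← Finset.mul_sum, ← harmonic_sub_harmonic hks]
    field_simp
  rw [h1]
  calc _ ≤ ∑ j ∈ Finset.range k, (1 : ℝ) := Finset.sum_le_sum fun j hj => by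
        have h2 : (j : ℝ) < k := by exact_mod_cast (Finset.mem_range.1 hj)
        rw [mul_one_div, div_le_one (by linarith)]
        linarith
    _ = k := by simp

lemma tendsto_maxUtilization :
    Tendsto (fun p : ℕ × ℕ => maxUtilization p.1 p.2)
      (comap (fun p : ℕ × ℕ => (p.2 : ℝ) / (p.1 : ℝ)) (𝓝 0) ⊓
        𝓟 {p : ℕ × ℕ | 1 ≤ p.2 ∧ p.2 ≤ p.1})
      (𝓝 1) := by
  have h : Tendsto (fun p : ℕ × ℕ => 1 - (p.2 : ℝ) / (p.1 : ℝ))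
      (comap (fun p : ℕ × ℕ => (p.2 : ℝ) / (p.1 : ℝ)) (𝓝 0) ⊓
        𝓟 {p : ℕ × ℕ | 1 ≤ p.2 ∧ p.2 ≤ p.1}) (𝓝 1) := by
    have h0 : Tendsto (fun p : ℕ × ℕ => (p.2 : ℝ) / (p.1 : ℝ))
      (comap (fun p : ℕ × ℕ => (p.2 : ℝ) / (p.1 : ℝ)) (𝓝 0) ⊓
        𝓟 {p : ℕ × ℕ | 1 ≤ p.2 ∧ p.2 ≤ p.1}) (𝓝 0) := tendsto_comap.mono_left inf_le_left
    simpa using h0.const_sub 1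
  have hmem : ∀ᶠ p : ℕ × ℕ in (comap (fun p : ℕ × ℕ => (p.2 : ℝ) / (p.1 : ℝ)) (𝓝 0) ⊓
        𝓟 {p : ℕ × ℕ | 1 ≤ p.2 ∧ p.2 ≤ p.1}), 1 ≤ p.2 ∧ p.2 ≤ p.1 :=
    mem_inf_of_right (mem_principal_self _)
  exact tendsto_of_tendsto_of_tendsto_of_le_of_le' h tendsto_const_nhds
    (hmem.mono fun p hp => one_sub_le_maxUtilization hp.1 hp.2)
    (hmem.mono fun p hp => maxUtilization_le_one hp.1 hp.2)

lemma utilization_lt_maxUtilization_iff {s k : ℕ} (hk : 1 ≤ k) (hks : k ≤ s) {lam : ℝ}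
    (hμ : 0 < μ) (hlam : 0 < lam) :
    utilization s k lam μ < maxUtilization s k ↔
      ((harmonic s : ℝ) - (harmonic (s - k) : ℝ)) / μ < 1 / lam := by
  have hk0 : (0 : ℝ) < k := by exact_mod_cast hk
  have hs0 : (0 : ℝ) < s := by exact_mod_cast hk.trans hks
  have := harmonic_sub_harmonic_pos hk hks
  set h := (harmonic s : ℝ) - (harmonic (s - k) : ℝ) with hh
  rw [utilization, maxUtilization, ← hh, div_lt_div_iff₀ (by positivity) (by positivity),
    div_lt_div_iff₀ hμ hlam]
  have e1 : (k : ℝ) * lam * (s * h) = (k * s) * (h * lam) := by ring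
  have e2 : (k : ℝ) * (s * μ) = (k * s) * (1 * μ) := by ring
  rw [e1, e2]
  exact mul_lt_mul_iff_right₀ (by positivity)

end Mean

/-! ### Independence and service processes -/

section Service

open scoped ENNReal

/-- Independent variables indexed by pairs may be grouped by the first index. -/
lemma iIndepFun_curry {Ω ι κ β : Type*} [MeasurableSpace Ω] [MeasurableSpace β] {P : Measure Ω}
    [IsProbabilityMeasure P] {X : ι → κ → Ω → β} (hX : ∀ i j, Measurable (X i j))
    (h : iIndepFun (fun p : ι × κ => X p.1 p.2) P) :
    iIndepFun (fun i ω j => X i j ω) P := by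
  have hm : ∀ i, Measurable fun ω j => X i j ω := fun i => measurable_pi_iff.2 (hX i)
  have hpr : ∀ i j, IsProbabilityMeasure (P.map (X i j)) := fun i j =>
    Measure.isProbabilityMeasure_map (hX i j).aemeasurable
  have hs : iIndepFun (fun (p : (_ : ι) × κ) ω => X p.1 p.2 ω) P :=
    h.precomp (g := fun p : (_ : ι) × κ => (p.1, p.2)) fun p p' hp => by
      cases p; cases p'; simp_all
  rw [iIndepFun_iff_map_fun_eq_infinitePi_map hm]
  have h1 := (iIndepFun_iff_map_fun_eq_infinitePi_map (fun p => hX _ _)).1 hs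
  have h2 := Measure.infinitePi_map_piCurry (fun i j => P.map (X i j))
  rw [← h1, Measure.map_map (by fun_prop) (measurable_pi_iff.2 fun p => hX _ _)] at h2
  refine h2.trans ?_
  congr 1
  funext i
  have hi : iIndepFun (X i) P := h.precomp (g := fun j => (i, j)) fun j j' hj => by
    simpa using hj
  exact ((iIndepFun_iff_map_fun_eq_infinitePi_map (hX i)).1 hi).symm

variable {Ω : Type*} [MeasurableSpace Ω]

/-- The service times `Q n j` of the tasks `j` of the jobs `n` are independent and exponential of
rate `μ`. -/
structure IsServiceProcess (P : Measure Ω) {k : ℕ} (μ : ℝ) (Q : ℕ → Fin k → Ω → ℝ) : Prop where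
  measurable : ∀ n j, Measurable (Q n j)
  map_eq : ∀ n j, P.map (Q n j) = expMeasure μ
  indep : iIndepFun (fun p : ℕ × Fin k => Q p.1 p.2) P

variable {P : Measure Ω} {s k : ℕ} {μ : ℝ} {Q : ℕ → Fin k → Ω → ℝ}

namespace IsServiceProcess

/-- Reindexing the jobs preserves the law of the service times. -/
lemma reindex (hQ : IsServiceProcess P μ Q) {g : ℕ → ℕ} (hg : Function.Injective g) :
    IsServiceProcess P μ fun n => Q (g n) where
  measurable n := hQ.measurable (g n)
  map_eq n := hQ.map_eq (g n)
  indep := hQ.indep.precomp (g := fun p : ℕ × Fin k => (g p.1, p.2)) fun p p' h => by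
    simp only [Prod.mk.injEq] at h
    exact Prod.ext (hg h.1) h.2

lemma measurable_path (hQ : IsServiceProcess P μ Q) : Measurable fun ω m j => Q m j ω :=
  measurable_pi_iff.2 fun m => measurable_pi_iff.2 fun j => hQ.measurable m j

lemma measurable_job (hQ : IsServiceProcess P μ Q) (n : ℕ) : Measurable fun ω j => Q n j ω :=
  measurable_pi_iff.2 fun j => hQ.measurable n j

lemma map_job (hQ : IsServiceProcess P μ Q) (n : ℕ) :
    P.map (fun ω j => Q n j ω) = Measure.pi fun _ => expMeasure μ := by
  have h : iIndepFun (Q n) P := hQ.indep.precomp (g := fun j => (n, j)) fun j j' hj => by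
    simpa using hj
  rw [h.map_fun_eq_pi_map fun j => (hQ.measurable n j).aemeasurable]
  simp only [hQ.map_eq]

lemma ae_pos (hQ : IsServiceProcess P μ Q) (hμ : 0 < μ) : ∀ᵐ ω ∂P, ∀ n j, 0 < Q n j ω :=
  ae_all_iff.2 fun n => ae_all_iff.2 fun j => by
    have h := ae_pos_expMeasure hμ
    rw [← hQ.map_eq n j] at h
    exact ae_of_ae_map (hQ.measurable n j).aemeasurable h

variable [IsProbabilityMeasure P]

/-- An event that depends only on the jobs before `n` is independent of the service times of
job `n`. -/
lemma measure_past_inter (hQ : IsServiceProcess P μ Q) {n : ℕ} {S : Set (ℕ → Fin k → ℝ)}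
    (hS : MeasurableSet S)
    (hdep : ∀ x y : ℕ → Fin k → ℝ, (∀ m < n, x m = y m) → x ∈ S → y ∈ S)
    {D : Set (Fin k → ℝ)} (hD : MeasurableSet D) :
    P ((fun ω m j => Q m j ω) ⁻¹' S ∩ (fun ω j => Q n j ω) ⁻¹' D) =
      P ((fun ω m j => Q m j ω) ⁻¹' S) * (Measure.pi fun _ => expMeasure μ) D := by
  have hind := (iIndepFun_curry hQ.measurable hQ.indep).indepFun_finset (Finset.range n) {n}
    (by simp) hQ.measurable_job
  let ext : (Finset.range n → Fin k → ℝ) → ℕ → Fin k → ℝ := fun y m =>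
    if h : m ∈ Finset.range n then y ⟨m, h⟩ else 0
  have hext : Measurable ext := by
    refine measurable_pi_iff.2 fun m => ?_
    by_cases h : m ∈ Finset.range n
    · simp only [ext, h, dif_pos]
      exact measurable_pi_apply (X := fun _ : Finset.range n => Fin k → ℝ) ⟨m, h⟩
    · simp only [ext, h, dif_neg, not_false_eq_true]; exact measurable_const
  have h1 : (fun ω m j => Q m j ω) ⁻¹' S =
      (fun ω (i : Finset.range n) j => Q i j ω) ⁻¹' (ext ⁻¹' S) := by
    ext ω
    constructor
    · refine hdep _ _ fun m hm => ?_
      simp [ext, hm]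
    · refine hdep _ _ fun m hm => ?_
      simp [ext, hm]
  have h2 : (fun ω j => Q n j ω) ⁻¹' D =
      (fun ω (i : ({n} : Finset ℕ)) j => Q i j ω) ⁻¹'
        ((fun y : ({n} : Finset ℕ) → Fin k → ℝ => y ⟨n, by simp⟩) ⁻¹' D) := rfl
  rw [h1, h2, hind.measure_inter_preimage_eq_mul _ _ (hext hS) (measurable_pi_apply _ hD), ← h2,
    ← hQ.map_job n, Measure.map_apply (hQ.measurable_job n) hD]

end IsServiceProcess

/-! ### The backlogged system -/

lemma freeTime_congr {A A' : ℕ → ℝ} {q q' : ℕ → Fin k → ℝ} {n : ℕ} (hA : ∀ m < n, A m = A' m)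
    (hq : ∀ m < n, q m = q' m) : freeTime s A q n = freeTime s A' q' n := by
  induction n with
  | zero => rfl
  | succ n ih =>
    have ih := ih (fun m hm => hA m (by omega)) (fun m hm => hq m (by omega))
    simp only [freeTime, ih, hA n (by omega), hq n (by omega)]

lemma startTime_congr {A A' : ℕ → ℝ} {q q' : ℕ → Fin k → ℝ} {n : ℕ} (hA : ∀ m ≤ n, A m = A' m)
    (hq : ∀ m < n, q m = q' m) : startTime s A q n = startTime s A' q' n := by
  rw [startTime, startTime, freeTime_congr (fun m hm => hA m hm.le) hq, hA n le_rfl]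

/-- The first job whose start fills all workers in the backlogged system. -/
def fillJob (s k : ℕ) : ℕ := (s - 1) / k

lemma fillJob_le_iff (hk : 1 ≤ k) (hks : k ≤ s) {n : ℕ} : fillJob s k ≤ n ↔ s ≤ (n + 1) * k := by
  rw [fillJob, ← Nat.lt_succ_iff, Nat.div_lt_iff_lt_mul (by omega)]
  have : 1 ≤ s := hk.trans hks
  simp only [Nat.succ_eq_add_one]
  omega

lemma fillJob_mul_lt (hk : 1 ≤ k) (hks : k ≤ s) : fillJob s k * k < s := by
  have := Nat.div_mul_le_self (s - 1) k
  rw [fillJob]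
  omega

/-- As long as idle workers remain under backlog, job `n` starts at time `0` on the workers
`n * k, …, n * k + k - 1`. -/
lemma freeTime_zero_of_mul_le (hk : 1 ≤ k) {q : ℕ → Fin k → ℝ} (hq : ∀ n j, 0 < q n j) {n : ℕ}
    (hn : n * k ≤ s) (i : Fin s) :
    freeTime s (fun _ => 0) q n i =
      if (i : ℕ) < n * k then q (i / k) ⟨i % k, Nat.mod_lt _ hk⟩ else 0 := by
  classical
  induction n generalizing i with
  | zero => simp [freeTime]
  | succ n ih =>
    have hn' : n * k + k ≤ s := by rwa [Nat.succ_mul] at hn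
    have ih := ih (by omega)
    set F := freeTime s (fun _ => 0) q n with hF
    have hlow : ∀ i : Fin s, (i : ℕ) < n * k → 0 < F i := fun i hi => by
      rw [ih i, if_pos hi]; exact hq _ _
    have hhigh : ∀ i : Fin s, n * k ≤ (i : ℕ) → F i = 0 := fun i hi => by
      rw [ih i, if_neg (by omega)]
    have hrank : ∀ i : Fin s, n * k ≤ (i : ℕ) → rank F i = i - n * k := by
      intro i hi
      have h1 : (Finset.univ.filter fun j => lexLT F j i) =
          Finset.Ico (⟨n * k, by omega⟩ : Fin s) i := by
        ext j
        simp only [Finset.mem_filter, Finset.mem_univ, true_and, Finset.mem_Ico, lexLT, hhigh i hi,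
          Fin.le_def, Fin.lt_def]
        rcases lt_or_ge (j : ℕ) (n * k) with hj | hj
        · have := hlow j hj
          constructor
          · rintro (h | h)
            · linarith
            · linarith [h.1]
          · omega
        · simp [hhigh j hj, hj]
      rw [rank]
      convert congrArg Finset.card h1
      simp
    have hrank' : ∀ i : Fin s, (i : ℕ) < n * k → k ≤ rank F i := by
      intro i hi
      by_contra hlt
      have h2 := hrank ⟨n * k + rank F i, by omega⟩ (by simp)
      simp only [Nat.add_sub_cancel_left] at h2
      have h3 := congrArg Fin.val (rank_injective F h2)
      simp only at h3
      omega
    have hstart : startTime s (fun _ => 0) q n = 0 := by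
      have h3 := hrank ⟨n * k + (k - 1), by omega⟩ (by simp)
      rw [Nat.add_sub_cancel_left] at h3
      rw [startTime, ← hF, orderStat_eq_of_rank hk h3, hhigh _ (by simp), max_self]
    rw [freeTime_succ, hstart, ← hF, assign_apply]
    have hmul : (n + 1) * k = n * k + k := Nat.succ_mul n k
    rcases lt_or_ge (i : ℕ) (n * k) with hi | hi
    · rw [dif_neg (not_lt.2 (hrank' i hi)), if_pos (by omega), ih i, if_pos hi]
    · have hr := hrank i hi
      by_cases hik : (i : ℕ) < n * k + k
      · rw [dif_pos (by omega), if_pos (by omega), zero_add]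
        have hdiv : (i : ℕ) / k = n := by
          rw [Nat.div_eq_iff (by omega)]
          omega
        have hmod : (i : ℕ) % k = i - n * k := by
          have := Nat.div_add_mod (i : ℕ) k
          rw [hdiv, mul_comm] at this
          omega
        congr 1
        · rw [hdiv]
        · exact Fin.ext (by simp only [hr, hmod])
      · rw [dif_neg (by omega), if_neg (by omega), hhigh i hi]

/-- The residual service times at the workers immediately after the start of job `n` under
backlog. -/
def residual (s : ℕ) {k : ℕ} (q : ℕ → Fin k → ℝ) (n : ℕ) : Fin s → ℝ := fun i =>
  freeTime s (fun _ => 0) q (n + 1) i - startTime s (fun _ => 0) q n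

lemma measurable_residual (hk : 1 ≤ k) (hks : k ≤ s) (n : ℕ) :
    Measurable fun q : ℕ → Fin k → ℝ => residual s q n := by
  have h1 := (measurable_freeTime (s := s) hk hks (n + 1)).comp
    (measurable_prodMk_left (x := fun _ : ℕ => (0 : ℝ)))
  have h2 := (measurable_startTime (s := s) hk hks n).comp
    (measurable_prodMk_left (x := fun _ : ℕ => (0 : ℝ)))
  exact measurable_pi_iff.2 fun i => ((measurable_pi_apply i).comp h1).sub h2

lemma measurable_backlogStart (hk : 1 ≤ k) (hks : k ≤ s) (n : ℕ) :
    Measurable fun q : ℕ → Fin k → ℝ => startTime s (fun _ => 0) q n :=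
  (measurable_startTime (s := s) hk hks n).comp
    (measurable_prodMk_left (x := fun _ : ℕ => (0 : ℝ)))

lemma measurable_backlogGap (hk : 1 ≤ k) (hks : k ≤ s) (n : ℕ) :
    Measurable fun q : ℕ → Fin k → ℝ => backlogGap s q n :=
  (measurable_backlogStart hk hks (n + 1)).sub (measurable_backlogStart hk hks n)

lemma backlogGap_eq (hk : 1 ≤ k) (hks : k ≤ s) {q : ℕ → Fin k → ℝ} (hq : ∀ n j, 0 ≤ q n j)
    (n : ℕ) : backlogGap s q n = orderStat k (residual s q n) := by
  have : residual s q n = fun i => freeTime s (fun _ => 0) q (n + 1) i -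
    startTime s (fun _ => 0) q n := rfl
  rw [this, orderStat_sub_const hk hks, backlogGap, startTime_zero_eq hk hks hq (n + 1)]

lemma residual_succ (hk : 1 ≤ k) (hks : k ≤ s) {q : ℕ → Fin k → ℝ} (hq : ∀ n j, 0 ≤ q n j)
    (n : ℕ) : residual s q (n + 1) = fun i =>
      assign (residual s q n) (orderStat k (residual s q n)) (q (n + 1)) i -
        orderStat k (residual s q n) := by
  funext i
  rw [← backlogGap_eq hk hks hq n]
  have := assign_sub_const (freeTime s (fun _ => 0) q (n + 1)) (startTime s (fun _ => 0) q (n + 1))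
    (startTime s (fun _ => 0) q n) (q (n + 1)) i
  have h2 : assign (residual s q n) (backlogGap s q n) (q (n + 1)) i = _ := this
  rw [h2, residual, freeTime_succ, backlogGap]
  ring

lemma residual_congr {q q' : ℕ → Fin k → ℝ} {n : ℕ} (h : ∀ m < n + 1, q m = q' m) :
    residual s q n = residual s q' n := by
  funext i
  rw [residual, residual, freeTime_congr (fun _ _ => rfl) h,
    startTime_congr (fun _ _ => rfl) fun m hm => h m (by omega)]

lemma backlogGap_congr {q q' : ℕ → Fin k → ℝ} {n : ℕ} (h : ∀ m < n + 1, q m = q' m) :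
    backlogGap s q n = backlogGap s q' n := by
  rw [backlogGap, backlogGap, startTime_congr (fun _ _ => rfl) h,
    startTime_congr (fun _ _ => rfl) fun m hm => h m (by omega)]

namespace IsServiceProcess

lemma measurable_gap (hQ : IsServiceProcess P μ Q) (hk : 1 ≤ k) (hks : k ≤ s) (n : ℕ) :
    Measurable fun ω => backlogGap s (fun m j => Q m j ω) n :=
  (measurable_backlogGap hk hks n).comp hQ.measurable_path

variable [IsProbabilityMeasure P]

/-- While idle workers remain, the times at which the workers become free are independent. -/
lemma map_freeTime_of_mul_le (hQ : IsServiceProcess P μ Q) (hμ : 0 < μ) (hk : 1 ≤ k) {n : ℕ}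
    (hn : n * k ≤ s) :
    P.map (fun ω => freeTime s (fun _ => 0) (fun m j => Q m j ω) n) =
      Measure.pi fun i : Fin s => if (i : ℕ) < n * k then expMeasure μ else Measure.dirac 0 := by
  let X : Fin s → Ω → ℝ := fun i ω =>
    if (i : ℕ) < n * k then Q (i / k) ⟨i % k, Nat.mod_lt _ hk⟩ ω else 0
  have hX : ∀ i, Measurable (X i) := fun i => by
    by_cases h : (i : ℕ) < n * k
    · simpa [X, h] using hQ.measurable _ _
    · simp [X, h]
  have hind : iIndepFun X P := by
    have h1 := hQ.indep.precomp
      (g := fun i : Fin s => ((i : ℕ) / k, (⟨i % k, Nat.mod_lt _ hk⟩ : Fin k)))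
      fun i j hij => by
        simp only [Prod.mk.injEq, Fin.mk.injEq] at hij
        apply Fin.ext
        rw [← Nat.div_add_mod (i : ℕ) k, ← Nat.div_add_mod (j : ℕ) k, hij.1, hij.2]
    have h2 := h1.comp (fun (i : Fin s) (x : ℝ) => if (i : ℕ) < n * k then x else 0)
      fun i => by split_ifs <;> fun_prop
    exact h2
  have hae : (fun ω => freeTime s (fun _ => 0) (fun m j => Q m j ω) n) =ᵐ[P] fun ω i => X i ω := by
    filter_upwards [hQ.ae_pos hμ] with ω hω
    funext i
    exact freeTime_zero_of_mul_le hk hω hn i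
  rw [Measure.map_congr hae, hind.map_fun_eq_pi_map fun i => (hX i).aemeasurable]
  congr 1
  funext i
  by_cases h : (i : ℕ) < n * k
  · have : X i = Q (i / k) ⟨i % k, Nat.mod_lt _ hk⟩ := by funext ω; simp [X, h]
    rw [this, hQ.map_eq, if_pos h]
  · have : X i = fun _ => 0 := by funext ω; simp [X, h]
    rw [this, Measure.map_const, if_neg h, measure_univ, one_smul]

/-- The event that the gaps of the jobs from the first filling one up to `n` lie in given sets. -/
def gapEvent (s : ℕ) {k : ℕ} (B : ℕ → Set ℝ) (n : ℕ) : Set (ℕ → Fin k → ℝ) :=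
  {q | ∀ m, fillJob s k ≤ m → m < n → backlogGap s q m ∈ B m}

lemma measurableSet_gapEvent (hk : 1 ≤ k) (hks : k ≤ s) {B : ℕ → Set ℝ}
    (hB : ∀ m, MeasurableSet (B m)) (n : ℕ) :
    MeasurableSet (gapEvent s B n : Set (ℕ → Fin k → ℝ)) := by
  have : (gapEvent s B n : Set (ℕ → Fin k → ℝ)) = ⋂ m, ⋂ (_ : fillJob s k ≤ m), ⋂ (_ : m < n),
      (fun q => backlogGap s q m) ⁻¹' B m := by
    ext q; simp [gapEvent]
  rw [this]
  exact MeasurableSet.iInter fun m => MeasurableSet.iInter fun _ => MeasurableSet.iInter fun _ =>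
    measurable_backlogGap hk hks m (hB m)

/-- Given an event of the past, the workers' times and the next tasks are independent. -/
lemma map_restrict_prod (hQ : IsServiceProcess P μ Q) (hμ : 0 < μ) {n : ℕ}
    {E : Set (ℕ → Fin k → ℝ)}
    (hE : MeasurableSet E) (hEdep : ∀ x y : ℕ → Fin k → ℝ, (∀ m < n, x m = y m) → x ∈ E → y ∈ E)
    {Z : (ℕ → Fin k → ℝ) → Fin s → ℝ} (hZ : Measurable Z)
    (hZdep : ∀ x y : ℕ → Fin k → ℝ, (∀ m < n, x m = y m) → Z x = Z y) :
    (P.restrict ((fun ω m j => Q m j ω) ⁻¹' E)).map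
        (fun ω => (Z (fun m j => Q m j ω), fun j => Q n j ω)) =
      ((P.restrict ((fun ω m j => Q m j ω) ⁻¹' E)).map fun ω => Z (fun m j => Q m j ω)).prod
        (Measure.pi fun _ => expMeasure μ) := by
  have := isProbabilityMeasure_expMeasure hμ
  have hZm : Measurable fun ω => Z (fun m j => Q m j ω) := hZ.comp hQ.measurable_path
  refine (Measure.prod_eq fun C D hC hD => ?_).symm
  rw [Measure.map_apply (hZm.prodMk (hQ.measurable_job n)) (hC.prod hD),
    Measure.restrict_apply ((hZm.prodMk (hQ.measurable_job n)) (hC.prod hD)),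
    Measure.map_apply hZm hC, Measure.restrict_apply (hZm hC)]
  have h := hQ.measure_past_inter (n := n) (S := Z ⁻¹' C ∩ E) ((hZ hC).inter hE)
    (fun x y hxy hx => ⟨by rw [Set.mem_preimage, ← hZdep x y hxy]; exact hx.1,
      hEdep x y hxy hx.2⟩) hD
  refine Eq.trans (congrArg P ?_) h
  ext ω
  simp only [Set.mem_inter_iff, Set.mem_preimage, Set.mem_prod]
  tauto

/-- Conditionally on the past gaps, the residual service times are independent exponential
variables. -/
lemma map_residual_restrict (hQ : IsServiceProcess P μ Q) (hμ : 0 < μ) (hk : 1 ≤ k) (hks : k ≤ s)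
    {B : ℕ → Set ℝ} (hB : ∀ m, MeasurableSet (B m)) {n : ℕ} (hn : fillJob s k ≤ n) :
    (P.restrict ((fun ω m j => Q m j ω) ⁻¹' gapEvent s B n)).map
        (fun ω => residual s (fun m j => Q m j ω) n) =
      (∏ m ∈ Finset.Ico (fillJob s k) n, expOrderStatLaw s k μ (B m)) •
        Measure.pi fun _ : Fin s => expMeasure μ := by
  have hprob := isProbabilityMeasure_expMeasure hμ
  have hpath := hQ.measurable_path
  have hΨ := measurable_orderStat_residual (s := s) hk hks
  induction n, hn using Nat.le_induction with
  | base =>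
    have huniv : (gapEvent s B (fillJob s k) : Set (ℕ → Fin k → ℝ)) = Set.univ := by
      refine Set.eq_univ_of_forall fun q m h1 h2 => ?_
      omega
    rw [huniv, Finset.Ico_self, Finset.prod_empty, one_smul]
    set n := fillJob s k with hn
    have hnk : n * k < s := fillJob_mul_lt hk hks
    have hks' : s ≤ (n + 1) * k := (fillJob_le_iff hk hks).1 hn.symm.le
    rw [Nat.succ_mul] at hks'
    have hfm : Measurable fun q : ℕ → Fin k → ℝ => freeTime s (fun _ => 0) q n :=
      (measurable_freeTime (s := s) hk hks n).comp
        (measurable_prodMk_left (x := fun _ : ℕ => (0 : ℝ)))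
    have h1 := hQ.map_restrict_prod hμ (n := n) (E := Set.univ) MeasurableSet.univ
      (fun _ _ _ _ => trivial) hfm (fun x y hxy => freeTime_congr (fun _ _ => rfl) hxy)
    rw [Set.preimage_univ, Measure.restrict_univ, hQ.map_freeTime_of_mul_le hμ hk hnk.le] at h1
    rw [Set.preimage_univ, Measure.restrict_univ]
    set m : Fin s → Measure ℝ := fun i =>
      if (i : ℕ) < n * k then expMeasure μ else Measure.dirac 0 with hm
    have hmp : ∀ i, IsProbabilityMeasure (m i) := fun i => by
      simp only [hm]; split_ifs <;> infer_instance
    have h0 : ∀ i, ∀ᵐ x ∂m i, 0 ≤ x := fun i => by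
      simp only [hm]; split_ifs
      · exact (ae_pos_expMeasure hμ).mono fun x hx => hx.le
      · rw [ae_dirac_iff measurableSet_Ici]
    have hlow : ∀ᵐ x ∂Measure.pi m, ∀ i : Fin s, (i : ℕ) < n * k → 0 < x i :=
      ae_all_iff.2 fun i => (measurePreserving_eval m i).quasiMeasurePreserving.ae
        (p := fun x => (i : ℕ) < n * k → 0 < x) (by
        simp only [hm]; split_ifs with hi
        · exact (ae_pos_expMeasure hμ).mono fun x hx _ => hx
        · exact .of_forall fun x h => absurd h hi)
    have hhigh : ∀ᵐ x ∂Measure.pi m, ∀ i : Fin s, ¬ (i : ℕ) < n * k → x i = 0 :=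
      ae_all_iff.2 fun i => (measurePreserving_eval m i).quasiMeasurePreserving.ae
        (p := fun x => ¬ (i : ℕ) < n * k → x = 0) (by
        simp only [hm]; split_ifs with hi
        · exact .of_forall fun x h => absurd hi h
        · rw [ae_dirac_eq]
          exact fun _ => rfl)
    -- at most `k` workers are idle, so they all receive a task of job `n`
    have hexp : ∀ᵐ x ∂Measure.pi m, ∀ j, k ≤ rank x j → m j = expMeasure μ := by
      filter_upwards [hlow, hhigh] with x hx1 hx2 j hj
      by_contra hcon
      have hj' : ¬ (j : ℕ) < n * k := fun h => hcon (by simp only [hm, if_pos h])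
      classical
      have hsub : (Finset.range (rank x j + 1)).card ≤
          (Finset.univ.filter fun i : Fin s => n * k ≤ (i : ℕ)).card := by
        have hrl := rank_lt x j
        refine Finset.card_le_card_of_injOn
          (fun r => if h : r < s then Tuple.sort x ⟨r, h⟩ else j) ?_ ?_
        · intro r hr
          have hr' : r < rank x j + 1 := by simpa using hr
          simp only [Finset.coe_filter, Finset.mem_univ, true_and, Set.mem_ofPred_eq]
          rw [dif_pos (by omega)]
          by_contra hlt
          have h3 := hx1 _ (not_le.1 hlt)
          have h4 : x (Tuple.sort x ⟨r, by omega⟩) ≤ x j :=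
            le_of_rank_le (by rw [rank_sort]; simp only; omega)
          rw [hx2 j hj'] at h4
          linarith
        · intro r hr r' hr' hrr
          have h3 : r < rank x j + 1 := by simpa using hr
          have h4 : r' < rank x j + 1 := by simpa using hr'
          simp only [dif_pos (show r < s by omega), dif_pos (show r' < s by omega)] at hrr
          simpa using (Tuple.sort x).injective hrr
      have hcard : (Finset.univ.filter fun i : Fin s => n * k ≤ (i : ℕ)).card = s - n * k := by
        have : (Finset.univ.filter fun i : Fin s => n * k ≤ (i : ℕ)) =
            Finset.Ici (⟨n * k, hnk⟩ : Fin s) := by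
          ext i; simp [Fin.le_def]
        rw [this, Fin.card_Ici]
      rw [Finset.card_range, hcard] at hsub
      omega
    have h2 := map_orderStat_residual hμ hk hks h0 hexp
    have hf : Measurable fun ω => freeTime s (fun _ => 0) (fun m j => Q m j ω) n := hfm.comp hpath
    rw [← h1, Measure.map_map hΨ (hf.prodMk (hQ.measurable_job n))] at h2
    have h3 := congrArg (Measure.map Prod.snd) h2
    have hmeas := hΨ.comp (hf.prodMk (hQ.measurable_job n))
    have hpm : IsProbabilityMeasure ((Measure.pi m).map (orderStat k)) :=
      Measure.isProbabilityMeasure_map (measurable_orderStat hk hks).aemeasurable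
    rw [Measure.map_map measurable_snd hmeas, Measure.map_snd_prod, measure_univ, one_smul] at h3
    rw [← h3]
    refine Measure.map_congr ?_
    filter_upwards [hQ.ae_pos hμ] with ω hω
    funext i
    rw [residual, freeTime_succ, startTime_zero_eq hk hks fun a b => (hω a b).le]
    rfl
  | succ n hn ih =>
    have h1 := hQ.map_restrict_prod hμ (n := n + 1) (measurableSet_gapEvent hk hks hB n)
      (fun x y hxy hx m h1 h2 => by
        rw [← backlogGap_congr (q := x) fun m' hm' => hxy m' (by omega)]; exact hx m h1 h2)
      (measurable_residual hk hks n) (fun x y hxy => residual_congr hxy)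
    have hres : Measurable fun ω => residual s (fun m j => Q m j ω) n :=
      (measurable_residual (s := s) hk hks n).comp hpath
    have h2 := map_orderStat_residual hμ hk hks (m := fun _ : Fin s => expMeasure μ)
      (fun _ => (ae_pos_expMeasure hμ).mono fun _ h => h.le) (.of_forall fun _ _ _ => rfl)
    rw [ih, Measure.prod_smul_left] at h1
    have h3 := congrArg (Measure.map fun y : (Fin s → ℝ) × (Fin k → ℝ) => ((orderStat k y.1,
        fun i => assign y.1 (orderStat k y.1) y.2 i - orderStat k y.1) : ℝ × (Fin s → ℝ))) h1
    rw [Measure.map_smul, h2, Measure.map_map hΨ (hres.prodMk (hQ.measurable_job (n + 1)))] at h3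
    refine Measure.ext fun C hC => ?_
    have h4 := congrArg (fun ρ => ρ (B n ×ˢ C)) h3
    simp only at h4
    have hmeas := hΨ.comp (hres.prodMk (hQ.measurable_job (n + 1)))
    rw [Measure.map_apply hmeas ((hB n).prod hC),
      Measure.restrict_apply (hmeas ((hB n).prod hC)), Measure.smul_apply,
      Measure.prod_prod, smul_eq_mul] at h4
    rw [Measure.smul_apply, smul_eq_mul, Finset.prod_Ico_succ_top hn]
    have h5 : (Measure.pi fun _ : Fin s => expMeasure μ).map (orderStat k) =
      expOrderStatLaw s k μ := rfl
    rw [h5] at h4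
    rw [mul_assoc, ← h4]
    have hres1 : Measurable fun ω => residual s (fun m j => Q m j ω) (n + 1) :=
      (measurable_residual (s := s) hk hks (n + 1)).comp hpath
    rw [Measure.map_apply hres1 hC, Measure.restrict_apply (hres1 hC)]
    refine measure_congr ?_
    filter_upwards [hQ.ae_pos hμ] with ω hω
    have hω' : ∀ a b, 0 ≤ Q a b ω := fun a b => (hω a b).le
    have e1 := backlogGap_eq (s := s) hk hks hω' n
    have e2 := residual_succ (s := s) hk hks hω' n
    apply propext
    change (residual s (fun m j => Q m j ω) (n + 1) ∈ C ∧ _) ↔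
      ((orderStat k (residual s (fun m j => Q m j ω) n) ∈ B n ∧
        (fun i => assign (residual s (fun m j => Q m j ω) n)
          (orderStat k (residual s (fun m j => Q m j ω) n)) (fun j => Q (n + 1) j ω) i -
            orderStat k (residual s (fun m j => Q m j ω) n)) ∈ C) ∧ _)
    rw [e2, ← e1]
    constructor
    · rintro ⟨ha, hb⟩
      exact ⟨⟨hb n hn (by omega), ha⟩, fun m h1 h2 => hb m h1 (by omega)⟩
    · rintro ⟨⟨ha, hb⟩, hc⟩
      refine ⟨hb, fun m h1 h2 => ?_⟩
      rcases Nat.lt_succ_iff_lt_or_eq.1 h2 with h | rfl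
      · exact hc m h1 h
      · exact ha

lemma map_residual (hQ : IsServiceProcess P μ Q) (hμ : 0 < μ) (hk : 1 ≤ k) (hks : k ≤ s)
    {n : ℕ} (hn : fillJob s k ≤ n) :
    P.map (fun ω => residual s (fun m j => Q m j ω) n) =
      Measure.pi fun _ : Fin s => expMeasure μ := by
  have hprob := isProbabilityMeasure_expMeasure hμ
  have h := hQ.map_residual_restrict hμ hk hks (B := fun _ => Set.univ)
    (fun _ => MeasurableSet.univ) hn
  have hpm : IsProbabilityMeasure (expOrderStatLaw s k μ) :=
    Measure.isProbabilityMeasure_map (measurable_orderStat hk hks).aemeasurable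
  have huniv : (gapEvent s (fun _ => Set.univ) n : Set (ℕ → Fin k → ℝ)) = Set.univ :=
    Set.eq_univ_of_forall fun q m _ _ => trivial
  simpa [huniv] using h

lemma ae_residual_pos (hQ : IsServiceProcess P μ Q) (hμ : 0 < μ) (hk : 1 ≤ k) (hks : k ≤ s) :
    ∀ᵐ ω ∂P, ∀ n, fillJob s k ≤ n → ∀ i, 0 < residual s (fun m j => Q m j ω) n i := by
  refine ae_all_iff.2 fun n => ?_
  by_cases hn : fillJob s k ≤ n
  · have h := ae_pos_pi_expMeasure hμ s
    rw [← hQ.map_residual hμ hk hks hn] at h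
    exact (ae_of_ae_map ((measurable_residual hk hks n).comp hQ.measurable_path).aemeasurable
      h).mono fun ω hω _ => hω
  · exact .of_forall fun ω h => absurd h hn

lemma hasLaw_gap (hQ : IsServiceProcess P μ Q) (hμ : 0 < μ) (hk : 1 ≤ k) (hks : k ≤ s)
    {n : ℕ} (hn : fillJob s k ≤ n) :
    HasLaw (fun ω => backlogGap s (fun m j => Q m j ω) n) (expOrderStatLaw s k μ) P := by
  refine ⟨(hQ.measurable_gap hk hks n).aemeasurable, ?_⟩
  have hres : Measurable fun ω => residual s (fun m j => Q m j ω) n :=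
    (measurable_residual hk hks n).comp hQ.measurable_path
  rw [expOrderStatLaw, ← hQ.map_residual hμ hk hks hn,
    Measure.map_map (measurable_orderStat hk hks) hres]
  refine Measure.map_congr ?_
  filter_upwards [hQ.ae_pos hμ] with ω hω
  exact backlogGap_eq hk hks (fun a b => (hω a b).le) n

lemma iIndepFun_gap (hQ : IsServiceProcess P μ Q) (hμ : 0 < μ) (hk : 1 ≤ k) (hks : k ≤ s) :
    iIndepFun (fun (n : {n : ℕ // fillJob s k ≤ n}) ω =>
      backlogGap s (fun m j => Q m j ω) n) P := by
  classical
  have hprob := isProbabilityMeasure_expMeasure hμ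
  have hpm : IsProbabilityMeasure (expOrderStatLaw s k μ) :=
    Measure.isProbabilityMeasure_map (measurable_orderStat hk hks).aemeasurable
  rw [iIndepFun_iff_measure_inter_preimage_eq_mul]
  intro S sets hsets
  let B : ℕ → Set ℝ := fun m =>
    if h : fillJob s k ≤ m then (if ⟨m, h⟩ ∈ S then sets ⟨m, h⟩ else Set.univ) else Set.univ
  have hBS : ∀ i ∈ S, B i = sets i := fun i hi => by
    simp [B, i.2, hi]
  have hB : ∀ m, MeasurableSet (B m) := fun m => by
    simp only [B]
    split_ifs with h1 h2
    · exact hsets _ h2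
    · exact MeasurableSet.univ
    · exact MeasurableSet.univ
  obtain ⟨N, hN⟩ : ∃ N, ∀ i ∈ S, (i : ℕ) < N :=
    ⟨S.sup (fun i => (i : ℕ)) + 1, fun i hi =>
      Nat.lt_succ_of_le (Finset.le_sup (f := fun i : {n : ℕ // fillJob s k ≤ n} => (i : ℕ)) hi)⟩
  have hmax : fillJob s k ≤ max (fillJob s k) N := le_max_left _ _
  have h := congrArg (fun ρ => ρ Set.univ) (hQ.map_residual_restrict hμ hk hks hB hmax)
  have hres : Measurable fun ω => residual s (fun m j => Q m j ω) (max (fillJob s k) N) :=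
    (measurable_residual hk hks _).comp hQ.measurable_path
  rw [Measure.map_apply hres MeasurableSet.univ,
    Set.preimage_univ, Measure.restrict_apply_univ, Measure.smul_apply, measure_univ, smul_eq_mul,
    mul_one] at h
  have hev : (⋂ i ∈ S, (fun ω => backlogGap s (fun m j => Q m j ω) i) ⁻¹' sets i) =
      (fun ω m j => Q m j ω) ⁻¹' gapEvent s B (max (fillJob s k) N) := by
    ext ω
    simp only [Set.mem_iInter, Set.mem_preimage, gapEvent, Set.mem_ofPred_eq]
    constructor
    · intro hω m hm _
      simp only [B, dif_pos hm]
      split_ifs with h2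
      · exact hω _ h2
      · trivial
    · intro hω i hi
      rw [← hBS i hi]
      exact hω i i.2 (lt_of_lt_of_le (hN i hi) (le_max_right _ _))
  rw [hev, h]
  have hprod : ∀ i ∈ S, P ((fun ω => backlogGap s (fun m j => Q m j ω) i) ⁻¹' sets i) =
      expOrderStatLaw s k μ (B i) := fun i hi => by
    rw [← (hQ.hasLaw_gap hμ hk hks i.2).map_eq, hBS i hi,
      Measure.map_apply (hQ.measurable_gap hk hks i) (hsets i hi)]
  rw [Finset.prod_congr rfl hprod]
  refine Eq.trans ?_ (Finset.prod_map S (Function.Embedding.subtype _)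
    (fun m => expOrderStatLaw s k μ (B m)))
  refine (Finset.prod_subset ?_ ?_).symm
  · intro m hm
    obtain ⟨i, hi, rfl⟩ := Finset.mem_map.1 hm
    exact Finset.mem_Ico.2 ⟨i.2, lt_of_lt_of_le (hN i hi) (le_max_right _ _)⟩
  · intro m hm hmS
    have hm1 := (Finset.mem_Ico.1 hm).1
    have : B m = Set.univ := by
      simp only [B, dif_pos hm1]
      rw [if_neg]
      exact fun h2 => hmS (Finset.mem_map.2 ⟨_, h2, rfl⟩)
    rw [this, measure_univ]

lemma memLp_two_gap (hQ : IsServiceProcess P μ Q) (hμ : 0 < μ) (hk : 1 ≤ k) (hks : k ≤ s)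
    {n : ℕ} (hn : fillJob s k ≤ n) :
    MemLp (fun ω => backlogGap s (fun m j => Q m j ω) n) 2 P := by
  have h := hQ.hasLaw_gap hμ hk hks hn
  have h2 : MemLp id 2 (expOrderStatLaw s k μ) := by
    rw [expOrderStatLaw, memLp_map_measure_iff aestronglyMeasurable_id
      (measurable_orderStat hk hks).aemeasurable]
    exact memLp_two_orderStat hμ hk hks
  rw [← h.map_eq, memLp_map_measure_iff aestronglyMeasurable_id h.aemeasurable] at h2
  exact h2

lemma integral_gap (hQ : IsServiceProcess P μ Q) (hμ : 0 < μ) (hk : 1 ≤ k) (hks : k ≤ s)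
    {n : ℕ} (hn : fillJob s k ≤ n) :
    ∫ ω, backlogGap s (fun m j => Q m j ω) n ∂P =
      ((harmonic s : ℝ) - (harmonic (s - k) : ℝ)) / μ := by
  rw [(hQ.hasLaw_gap hμ hk hks hn).integral_eq, expOrderStatLaw,
    integral_map (f := fun x => x) (measurable_orderStat hk hks).aemeasurable
      aestronglyMeasurable_id, ← integral_orderStat hμ hk hks]

end IsServiceProcess
end Service

/-! ### Instability at and above the critical load -/

section Instability

open scoped ENNReal NNReal

variable {Ω : Type*} [MeasurableSpace Ω] {P : Measure Ω}

lemma gaussianReal_zero_pos_of_isOpen {v : ℝ≥0} (hv : v ≠ 0) {U : Set ℝ} (hU : IsOpen U)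
    (hne : U.Nonempty) : 0 < gaussianReal 0 v U := by
  rw [pos_iff_ne_zero]
  exact fun h => hU.measure_ne_zero volume hne (gaussianReal_absolutelyContinuous' 0 hv h)

/-- By the central limit theorem, centred and normalized sums charge an open set that is charged by
the limiting Gaussian law. -/
lemma eventually_le_measure_normalized_sum [IsProbabilityMeasure P] {X : ℕ → Ω → ℝ}
    (hX : MemLp (X 0) 2 P) (hind : iIndepFun X P) (hid : ∀ i, IdentDistrib (X i) (X 0) P P)
    {U : Set ℝ} (hU : IsOpen U) (hpos : 0 < gaussianReal 0 Var[X 0; P].toNNReal U) :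
    ∃ c : ℝ≥0∞, 0 < c ∧ ∀ᶠ n : ℕ in atTop,
      c ≤ P {ω | (√n)⁻¹ * (∑ i ∈ Finset.range n, X i ω - n * P[X 0]) ∈ U} := by
  have hclt := tendstoInDistribution_inv_sqrt_mul_sum_sub (P := P)
    (P' := gaussianReal 0 Var[X 0; P].toNNReal) (Y := id) ⟨aemeasurable_id, Measure.map_id⟩
    hX hind hid
  have h := ProbabilityMeasure.le_liminf_measure_open_of_tendsto hclt.tendsto hU
  simp only [ProbabilityMeasure.coe_mk, Measure.map_id] at h
  obtain ⟨c, hc0, hc⟩ := exists_between (hpos.trans_le h)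
  refine ⟨c, hc0, (eventually_lt_of_lt_liminf hc).mono fun n hn => ?_⟩
  rw [Measure.map_apply_of_aemeasurable (hclt.forall_aemeasurable n) hU.measurableSet] at hn
  exact hn.le

variable {s k : ℕ} {μ lam : ℝ} {T : ℕ → Ω → ℝ} {Q : ℕ → Fin k → Ω → ℝ}

/-- The inter-arrival times `T n` are exponential of rate `lam`, the service times `Q n j` are
exponential of rate `μ`, and all of them are independent. -/
structure IsQueueInput (P : Measure Ω) {k : ℕ} (lam μ : ℝ) (T : ℕ → Ω → ℝ)
    (Q : ℕ → Fin k → Ω → ℝ) : Prop where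
  measurable_arrival : ∀ n, Measurable (T n)
  measurable_service : ∀ n j, Measurable (Q n j)
  map_arrival : ∀ n, P.map (T n) = expMeasure lam
  map_service : ∀ n j, P.map (Q n j) = expMeasure μ
  indep : iIndepFun (Sum.elim T (fun p : ℕ × Fin k => Q p.1 p.2)) P

namespace IsQueueInput

lemma service_input (h : IsQueueInput P lam μ T Q) : IsServiceProcess P μ Q where
  measurable := h.measurable_service
  map_eq := h.map_service
  indep := h.indep.precomp (g := Sum.inr) Sum.inr_injective

lemma iIndepFun_arrival (h : IsQueueInput P lam μ T Q) : iIndepFun T P :=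
  h.indep.precomp (g := Sum.inl) Sum.inl_injective

lemma identDistrib_arrival (h : IsQueueInput P lam μ T Q) (i j : ℕ) :
    IdentDistrib (T i) (T j) P P :=
  ⟨(h.measurable_arrival i).aemeasurable, (h.measurable_arrival j).aemeasurable, by
    rw [h.map_arrival, h.map_arrival]⟩

lemma measurable_elim (h : IsQueueInput P lam μ T Q) (i : ℕ ⊕ ℕ × Fin k) :
    Measurable (Sum.elim T (fun p : ℕ × Fin k => Q p.1 p.2) i) := by
  cases i
  · exact h.measurable_arrival _
  · exact h.measurable_service _ _

lemma memLp_two_arrival (h : IsQueueInput P lam μ T Q) (hlam : 0 < lam) (n : ℕ) :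
    MemLp (T n) 2 P := by
  have h2 := memLp_two_id_expMeasure hlam
  rw [← h.map_arrival n, memLp_map_measure_iff aestronglyMeasurable_id
    (h.measurable_arrival n).aemeasurable] at h2
  exact h2

lemma integral_arrival (h : IsQueueInput P lam μ T Q) (hlam : 0 < lam) (n : ℕ) :
    ∫ ω, T n ω ∂P = 1 / lam := by
  rw [← integral_id_expMeasure hlam, ← h.map_arrival n,
    integral_map (h.measurable_arrival n).aemeasurable (by fun_prop)]

lemma ae_arrival_pos (h : IsQueueInput P lam μ T Q) (hlam : 0 < lam) : ∀ᵐ ω ∂P, ∀ n, 0 < T n ω :=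
  ae_all_iff.2 fun n => by
    have h1 := ae_pos_expMeasure hlam
    rw [← h.map_arrival n] at h1
    exact ae_of_ae_map (h.measurable_arrival n).aemeasurable h1

variable [IsProbabilityMeasure P]

lemma indepFun_arrival_service (h : IsQueueInput P lam μ T Q) :
    IndepFun (fun ω n => T n ω) (fun ω (p : ℕ × Fin k) => Q p.1 p.2 ω) P := by
  refine IndepFun.process_indepFun_process h.measurable_arrival
    (fun p => h.measurable_service p.1 p.2) fun I J => ?_
  have hd : Disjoint (I.map (Function.Embedding.inl : ℕ ↪ ℕ ⊕ ℕ × Fin k))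
      (J.map Function.Embedding.inr) := by
    rw [Finset.disjoint_left]
    intro x hx hx'
    obtain ⟨a, _, rfl⟩ := Finset.mem_map.1 hx
    obtain ⟨b, _, hb⟩ := Finset.mem_map.1 hx'
    simp at hb
  have h1 := h.indep.indepFun_finset _ _ hd h.measurable_elim
  exact h1.comp
    (φ := fun y (i : I) => y ⟨Sum.inl i, Finset.mem_map_of_mem _ i.2⟩)
    (ψ := fun y (j : J) => y ⟨Sum.inr j, Finset.mem_map_of_mem _ j.2⟩)
    (measurable_pi_iff.2 fun i => measurable_pi_apply _)
    (measurable_pi_iff.2 fun j => measurable_pi_apply _)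

lemma variance_arrival_ne_zero (h : IsQueueInput P lam μ T Q) (hlam : 0 < lam) :
    Var[T 0; P] ≠ 0 := by
  intro h0
  have h1 := ae_eq_integral_of_variance_eq_zero (h.memLp_two_arrival hlam 0) h0
  have hna := nullSingletonClass_expMeasure lam
  have h2 : P (T 0 ⁻¹' {P[T 0]}) = 0 := by
    rw [← Measure.map_apply (h.measurable_arrival 0) (measurableSet_singleton _), h.map_arrival]
    exact measure_singleton _
  have h3 : P (T 0 ⁻¹' {P[T 0]}) = 1 :=
    (measure_congr (eventuallyEq_univ.2 h1)).trans measure_univ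
  rw [h2] at h3
  exact zero_ne_one h3

end IsQueueInput

variable [IsProbabilityMeasure P]

lemma backlogStart_add_eq_sum (q : ℕ → Fin k → ℝ) (n j : ℕ) :
    startTime s (fun _ => 0) q (n + j) =
      startTime s (fun _ => 0) q n + ∑ i ∈ Finset.range j, backlogGap s q (n + i) := by
  induction j with
  | zero => simp
  | succ j ih =>
    rw [Finset.sum_range_succ, ← add_assoc (startTime s _ q n), ← ih, backlogGap]
    ring_nf

/-- The backlogged system starts every job earlier. -/
lemma backlogStart_le_startTime (hk : 1 ≤ k) (hks : k ≤ s) {A : ℕ → ℝ} (hA : ∀ n, 0 ≤ A n)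
    (q : ℕ → Fin k → ℝ) (n : ℕ) : startTime s (fun _ => 0) q n ≤ startTime s A q n := by
  have h := freeTime_dominated hk hks (A := fun _ => 0) (A' := A) (q := q) (q' := q) (n := 0)
    (n' := 0) (N := n) (a := 0) (c := 0) (.of_le fun j => by simp [freeTime]) (fun _ _ => rfl)
    (fun i _ => by simpa using hA _) (fun i _ => by simpa using hA _) n le_rfl
  have h2 := startTime_le_of_dominated hk hks h (by simpa using hA _) (by simpa using hA _)
  simpa using h2

/-- If the backlogged system is on average not faster than the arrivals, the delays are not tight:
the difference between the backlogged start times and the arrival times fluctuates at least on the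
scale of the square root of the number of jobs. -/
theorem lt_of_stableDelay (hin : IsQueueInput P lam μ T Q) (hk : 1 ≤ k) (hks : k ≤ s)
    (hlam : 0 < lam) (hμ : 0 < μ) {X : ℕ → Ω → ℝ} (hX : StableDelay P X)
    (hle : ∀ᵐ ω ∂P, ∀ n, startTime s (fun _ => 0) (fun m j => Q m j ω) n -
      arrivalTime (fun m => T m ω) n ≤ X n ω) :
    ((harmonic s : ℝ) - (harmonic (s - k) : ℝ)) / μ < 1 / lam := by
  by_contra hcon
  rw [not_lt] at hcon
  have hQ := hin.service_input
  set a := ((harmonic s : ℝ) - (harmonic (s - k) : ℝ)) / μ with ha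
  set f := fillJob s k with hf
  let G : ℕ → Ω → ℝ := fun i ω => backlogGap s (fun m j => Q m j ω) (f + i)
  have hGind : iIndepFun G P := (hQ.iIndepFun_gap hμ hk hks).precomp
    (g := fun i : ℕ => (⟨f + i, Nat.le_add_right _ _⟩ : {n : ℕ // fillJob s k ≤ n}))
    fun i j hij => by simpa using hij
  have hGlaw : ∀ i, HasLaw (G i) (expOrderStatLaw s k μ) P := fun i =>
    hQ.hasLaw_gap hμ hk hks (Nat.le_add_right _ _)
  have hGid : ∀ i, IdentDistrib (G i) (G 0) P P := fun i =>
    ⟨(hGlaw i).aemeasurable, (hGlaw 0).aemeasurable, by rw [(hGlaw i).map_eq, (hGlaw 0).map_eq]⟩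
  have hGmean : P[G 0] = a := hQ.integral_gap hμ hk hks (Nat.le_add_right _ _)
  have hGpos : 0 < gaussianReal 0 Var[G 0; P].toNNReal (Set.Ioi (-1)) := by
    by_cases hv : Var[G 0; P].toNNReal = 0
    · rw [hv, gaussianReal_zero_var, Measure.dirac_apply' _ measurableSet_Ioi]
      simp
    · exact gaussianReal_zero_pos_of_isOpen hv isOpen_Ioi ⟨0, by simp⟩
  obtain ⟨c₁, hc₁, hG⟩ := eventually_le_measure_normalized_sum
    (hQ.memLp_two_gap hμ hk hks (Nat.le_add_right _ _)) hGind hGid isOpen_Ioi hGpos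
  have hTpos : 0 < gaussianReal 0 Var[T 0; P].toNNReal (Set.Iio (-2)) := by
    refine gaussianReal_zero_pos_of_isOpen ?_ isOpen_Iio ⟨-3, by norm_num⟩
    rw [ne_eq, Real.toNNReal_eq_zero, not_le]
    exact lt_of_le_of_ne (variance_nonneg _ _) (hin.variance_arrival_ne_zero hlam).symm
  obtain ⟨c₂, hc₂, hT⟩ := eventually_le_measure_normalized_sum (hin.memLp_two_arrival hlam 0)
    hin.iIndepFun_arrival (fun i => hin.identDistrib_arrival i 0) isOpen_Iio hTpos
  rw [hGmean] at hG
  rw [hin.integral_arrival hlam 0] at hT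
  -- the product of the two probabilities bounds the probability of a large delay from below
  have hc : 0 < c₁ * c₂ := ENNReal.mul_pos hc₁.ne' hc₂.ne'
  obtain ⟨ν, hν, hlim⟩ := hX
  obtain ⟨K, hK⟩ : ∃ K : ℝ, 1 - c₁ * c₂ < ν (Set.Iio K) := by
    have h1 := tendsto_measure_Iic_atTop ν
    rw [measure_univ] at h1
    have h2 : 1 - c₁ * c₂ < 1 := ENNReal.sub_lt_self ENNReal.one_ne_top one_ne_zero hc.ne'
    obtain ⟨K, hK⟩ := (h1.eventually (lt_mem_nhds h2)).exists
    exact ⟨K + 1, hK.trans_le (measure_mono fun x hx =>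
      lt_of_le_of_lt (Set.mem_Iic.1 hx) (lt_add_one K))⟩
  have hopen := ProbabilityMeasure.le_liminf_measure_open_of_tendsto hlim.tendsto
    (isOpen_Iio (a := K))
  simp only [ProbabilityMeasure.coe_mk, Measure.map_id] at hopen
  have hXlt := eventually_lt_of_lt_liminf (hK.trans_le hopen)
  have hsqrt : Tendsto (fun j : ℕ => √((f + j + 1 : ℕ) : ℝ)) atTop atTop := by
    have h1 : Tendsto (fun j : ℕ => f + j + 1) atTop atTop :=
      (tendsto_add_atTop_nat (f + 1)).congr fun j => by omega
    exact Real.tendsto_sqrt_atTop.comp (tendsto_natCast_atTop_atTop.comp h1)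
  have hshift : Tendsto (fun j : ℕ => f + j + 1) atTop atTop :=
    (tendsto_add_atTop_nat (f + 1)).congr fun j => by omega
  have hshift' : Tendsto (fun j : ℕ => f + j) atTop atTop :=
    (tendsto_add_atTop_nat f).congr fun j => by omega
  obtain ⟨j, hj1, hj2, hj3, hj4, hj5⟩ := (hG.and ((hshift.eventually hT).and
    ((hshift'.eventually hXlt).and ((hsqrt.eventually_ge_atTop (K + (f + 1) / lam)).and
      (eventually_gt_atTop 0))))).exists
  set N := f + j + 1 with hN
  set E₁ := {ω | (√(j : ℝ))⁻¹ * (∑ i ∈ Finset.range j, G i ω - j * a) ∈ Set.Ioi (-1 : ℝ)} with hE₁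
  set E₂ := {ω | (√(N : ℝ))⁻¹ * (∑ i ∈ Finset.range N, T i ω - N * (1 / lam)) ∈
    Set.Iio (-2 : ℝ)} with hE₂
  have hinter : P (E₂ ∩ E₁) = P E₂ * P E₁ := by
    have h1 : IndepFun (fun ω => (√(N : ℝ))⁻¹ * (∑ i ∈ Finset.range N, T i ω - N * (1 / lam)))
        (fun ω => (√(j : ℝ))⁻¹ * (∑ i ∈ Finset.range j, G i ω - j * a)) P := by
      refine hin.indepFun_arrival_service.comp
        (φ := fun t : ℕ → ℝ => (√(N : ℝ))⁻¹ * (∑ i ∈ Finset.range N, t i - N * (1 / lam)))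
        (ψ := fun q : ℕ × Fin k → ℝ => (√(j : ℝ))⁻¹ *
          (∑ i ∈ Finset.range j, backlogGap s (fun m l => q (m, l)) (f + i) - j * a))
        (by fun_prop) ?_
      have hcur : Measurable fun (q : ℕ × Fin k → ℝ) (m : ℕ) (l : Fin k) => q (m, l) := by
        fun_prop
      exact ((Finset.measurable_sum _ fun i _ =>
        (measurable_backlogGap hk hks (f + i)).comp hcur).sub_const _).const_mul _
    exact h1.measure_inter_preimage_eq_mul _ _ measurableSet_Iio measurableSet_Ioi
  have hsub : P (E₂ ∩ E₁) ≤ P (X (f + j) ⁻¹' Set.Ici K) := by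
    refine measure_mono_ae ?_
    filter_upwards [hle, hQ.ae_pos hμ, hin.ae_arrival_pos hlam] with ω hω hq ht hmem
    obtain ⟨hm2, hm1⟩ : ω ∈ E₂ ∩ E₁ := hmem
    rw [hE₁, Set.mem_ofPred_eq, Set.mem_Ioi] at hm1
    rw [hE₂, Set.mem_ofPred_eq, Set.mem_Iio] at hm2
    have hsj : 0 < √(j : ℝ) := Real.sqrt_pos.2 (by exact_mod_cast hj5)
    have hsN : 0 < √(N : ℝ) := Real.sqrt_pos.2 (by rw [hN]; positivity)
    have hsjN : √(j : ℝ) ≤ √(N : ℝ) := Real.sqrt_le_sqrt (by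
      rw [hN]; push_cast
      have : (0 : ℝ) ≤ f := by positivity
      linarith)
    rw [inv_mul_eq_div, lt_div_iff₀ hsj] at hm1
    rw [inv_mul_eq_div, div_lt_iff₀ hsN] at hm2
    have h1 := hω (f + j)
    rw [backlogStart_add_eq_sum, startTime_zero_eq hk hks fun n i => (hq n i).le] at h1
    have h2 := orderStat_freeTime_nonneg (s := s) hk hks (A := fun _ => 0)
      (fun n i => (hq n i).le) f
    have h3 : arrivalTime (fun m => T m ω) (f + j) = ∑ i ∈ Finset.range N, T i ω := rfl
    rw [h3] at h1
    have h4 : (j : ℝ) * (1 / lam) ≤ j * a := mul_le_mul_of_nonneg_left hcon (by positivity)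
    have h5 : (N : ℝ) * (1 / lam) = j * (1 / lam) + (f + 1) / lam := by
      rw [hN]; push_cast; ring
    change K ≤ X (f + j) ω
    have h6 : ∑ i ∈ Finset.range j, backlogGap s (fun m j => Q m j ω) (f + i) =
      ∑ i ∈ Finset.range j, G i ω := rfl
    rw [h6] at h1
    linarith
  rw [hinter] at hsub
  have hXm : AEMeasurable (X (f + j)) P := hlim.forall_aemeasurable _
  rw [Measure.map_apply_of_aemeasurable hXm measurableSet_Iio] at hj3
  have hcompl : P (X (f + j) ⁻¹' Set.Iio K) = 1 - P (X (f + j) ⁻¹' Set.Ici K) := by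
    have h1 : X (f + j) ⁻¹' Set.Ici K = (X (f + j) ⁻¹' Set.Iio K)ᶜ := by
      ext ω; simp
    rw [h1, prob_compl_eq_one_sub₀ (hXm.nullMeasurableSet_preimage measurableSet_Iio),
      ENNReal.sub_sub_cancel ENNReal.one_ne_top prob_le_one]
  rw [hcompl] at hj3
  refine absurd hj3 (not_lt.2 (tsub_le_tsub_left ?_ _))
  rw [mul_comm]
  exact (mul_le_mul' hj2 hj1).trans hsub

end Instability

/-! ### Time reversal and blocks of jobs -/

section Reversal

variable {s k : ℕ}

/-- The involution of `ℕ` that reverses the order of `0, …, n` and fixes all larger numbers. -/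
def rev (n i : ℕ) : ℕ := if i ≤ n then n - i else i

lemma rev_of_le {n i : ℕ} (h : i ≤ n) : rev n i = n - i := if_pos h

lemma rev_injective (n : ℕ) : Function.Injective (rev n) := by
  intro i j h
  simp only [rev] at h
  split_ifs at h <;> omega

lemma arrivalTime_rev_add_sum (t : ℕ → ℝ) {n i : ℕ} (hi : i ≤ n) :
    arrivalTime (fun m => t (rev n m)) i + ∑ u ∈ Finset.range (n - i), t u =
      ∑ u ∈ Finset.range (n + 1), t u := by
  induction i with
  | zero =>
    rw [Finset.sum_range_succ]
    simp [arrivalTime, rev, add_comm]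
  | succ i ih =>
    rw [← ih (by omega), arrivalTime, Finset.sum_range_succ, ← arrivalTime, rev_of_le hi,
      show n - i = n - (i + 1) + 1 by omega, Finset.sum_range_succ]
    ring

lemma arrivalTime_nonneg {t : ℕ → ℝ} (ht : ∀ n, 0 ≤ t n) (n : ℕ) : 0 ≤ arrivalTime t n :=
  Finset.sum_nonneg fun _ _ => ht _

lemma arrivalTime_mono {t : ℕ → ℝ} (ht : ∀ n, 0 ≤ t n) : Monotone (arrivalTime t) := fun _ _ h =>
  Finset.sum_le_sum_of_subset_of_nonneg (Finset.range_mono (by omega)) fun _ _ _ => ht _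

/-- The waiting time of job `n` if the input of the jobs `0, …, n` is fed in reverse order. -/
def revWaitingTime (s : ℕ) {k : ℕ} (t : ℕ → ℝ) (q : ℕ → Fin k → ℝ) (n : ℕ) : ℝ :=
  waitingTime s (arrivalTime fun i => t (rev n i)) (fun i => q (rev n i)) n

/-- Reversing time turns the dependence on `n` into a job added at the beginning, which can only
delay the others. -/
lemma monotone_revWaitingTime (hk : 1 ≤ k) (hks : k ≤ s) {t : ℕ → ℝ} (ht : ∀ n, 0 ≤ t n)
    (q : ℕ → Fin k → ℝ) : Monotone (revWaitingTime s t q) := by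
  refine monotone_nat_of_le_succ fun n => ?_
  have hrev : ∀ i ≤ n, rev (n + 1) (1 + i) = rev n i := fun i hi => by
    rw [rev_of_le hi, rev_of_le (by omega)]; omega
  set A := arrivalTime fun i => t (rev n i) with hA
  set A' := arrivalTime fun i => t (rev (n + 1) i) with hA'
  have hAA : ∀ i ≤ n, A i = A' (1 + i) + -t (n + 1) := fun i hi => by
    rw [hA, hA', arrivalTime, arrivalTime, show 1 + i + 1 = (i + 1) + 1 by omega,
      Finset.sum_range_succ' _ (i + 1), rev_of_le (Nat.zero_le _), Nat.sub_zero,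
      add_neg_cancel_right]
    refine Finset.sum_congr rfl fun l hl => ?_
    rw [add_comm l 1, hrev l (by have := Finset.mem_range.1 hl; omega)]
  have hA0 : ∀ i, 0 ≤ A i := arrivalTime_nonneg fun i => ht _
  have hdom := freeTime_dominated hk hks (A := A) (A' := A') (q := fun i => q (rev n i))
    (q' := fun i => q (rev (n + 1) i)) (n := 0) (n' := 1) (N := n) (a := 0) (c := -t (n + 1))
    (.of_le fun j => by simp [freeTime]) (fun i hi => by rw [hrev i hi.le, Nat.zero_add])
    (fun i hi => by rw [Nat.zero_add, hAA i hi.le])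
    (fun i hi => by rw [← hAA i hi.le]; exact hA0 i) n le_rfl
  rw [Nat.zero_add] at hdom
  have h := startTime_le_of_dominated hk hks hdom (hAA n le_rfl).le
    (by rw [← hAA n le_rfl]; exact hA0 n)
  have h2 := hAA n le_rfl
  rw [revWaitingTime, revWaitingTime, waitingTime, waitingTime, ← hA, ← hA']
  rw [add_comm 1 n] at h h2
  linarith

/-- A time by which the backlogged system has completed the jobs `0, …, l`. -/
def drainTime (s : ℕ) {k : ℕ} (l : ℕ) (q : ℕ → Fin k → ℝ) : ℝ :=
  startTime s (fun _ => 0) q l + ∑ i, |residual s q l i|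

lemma drainTime_congr {q q' : ℕ → Fin k → ℝ} {l : ℕ} (h : ∀ m < l + 1, q m = q' m) :
    drainTime s l q = drainTime s l q' := by
  rw [drainTime, drainTime, residual_congr h,
    startTime_congr (fun _ _ => rfl) fun m hm => h m (by omega)]

lemma freeTime_zero_le_drainTime (q : ℕ → Fin k → ℝ) (l : ℕ) (i : Fin s) :
    freeTime s (fun _ => 0) q (l + 1) i ≤ drainTime s l q := by
  have h1 : |residual s q l i| ≤ ∑ i, |residual s q l i| :=
    Finset.single_le_sum (f := fun i => |residual s q l i|) (fun _ _ => abs_nonneg _)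
      (Finset.mem_univ i)
  have h2 := le_abs_self (residual s q l i)
  have h3 : residual s q l i = freeTime s (fun _ => 0) q (l + 1) i - startTime s (fun _ => 0) q l :=
    rfl
  rw [drainTime]
  linarith

lemma drainTime_nonneg (q : ℕ → Fin k → ℝ) (l : ℕ) : 0 ≤ drainTime s l q :=
  add_nonneg (le_max_left _ _) (Finset.sum_nonneg fun _ _ => abs_nonneg _)

/-- If all workers are free and all jobs of a block have arrived by time `c`, then the block is
complete after a further drain time. -/
lemma freeTime_add_le (hk : 1 ≤ k) (hks : k ≤ s) {A : ℕ → ℝ} {q : ℕ → Fin k → ℝ} {n l : ℕ} {c : ℝ}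
    (hF : ∀ i, freeTime s A q n i ≤ c) (hA : ∀ r < l + 1, A (n + r) ≤ c) (i : Fin s) :
    freeTime s A q (n + (l + 1)) i ≤ c + drainTime s l fun m => q (n + m) := by
  have h := freeTime_dominated hk hks (A := A) (A' := fun _ => 0) (q := q)
    (q' := fun m => q (n + m)) (n := n) (n' := 0) (N := l + 1) (a := c) (c := c)
    (.of_le fun j => by simp [freeTime, hF j]) (fun r _ => by rw [Nat.zero_add])
    (fun r hr => by simpa using hA r hr) (fun _ _ => by simp) (l + 1) le_rfl
  have h1 := h ((Tuple.sort (freeTime s A q (n + (l + 1)))).symm i)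
  rw [Equiv.apply_symm_apply] at h1
  refine h1.trans (max_le ?_ ?_)
  · rw [Nat.zero_add, add_comm c]
    exact add_le_add_left (freeTime_zero_le_drainTime _ _ _) c
  · exact le_add_of_nonneg_right (drainTime_nonneg _ _)

/-- The block bound, iterated over blocks of `l + 1` jobs: some block waits for its last arrival,
and from then on the blocks follow each other. -/
lemma freeTime_mul_le (hk : 1 ≤ k) (hks : k ≤ s) {A : ℕ → ℝ} {q : ℕ → Fin k → ℝ} {l : ℕ}
    (hA : Monotone A) (hA0 : ∀ n, 0 ≤ A n) (j : ℕ) {G : ℝ} (hG : 0 ≤ G)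
    (h : ∀ b < j, A ((j - 1 - b) * (l + 1) + l) + ∑ b' ∈ Finset.range (b + 1),
      drainTime s l (fun m => q ((j - 1 - b') * (l + 1) + m)) ≤ G) (i : Fin s) :
    freeTime s A q (j * (l + 1)) i ≤ G := by
  induction j generalizing G i with
  | zero => simpa [freeTime] using hG
  | succ j ih =>
    set d := drainTime s l (fun m => q (j * (l + 1) + m)) with hd
    have h0 := h 0 (by omega)
    simp only [Nat.add_sub_cancel, Nat.sub_zero, zero_add, Finset.sum_range_one] at h0
    rw [← hd] at h0
    have h1 := freeTime_add_le hk hks (A := A) (q := q) (n := j * (l + 1)) (l := l) (c := G - d)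
      (ih (by linarith [hA0 (j * (l + 1) + l)]) fun b hb => ?_)
      (fun r hr => (hA (show j * (l + 1) + r ≤ j * (l + 1) + l by omega)).trans (by linarith)) i
    · rw [← hd, sub_add_cancel] at h1
      rwa [Nat.succ_mul]
    · have h2 := h (b + 1) (by omega)
      rw [Finset.sum_range_succ'] at h2
      have e : ∀ b', j + 1 - 1 - (b' + 1) = j - 1 - b' := fun b' => by omega
      simp only [e] at h2
      simp only [Nat.add_sub_cancel, Nat.sub_zero] at h2
      rw [← hd] at h2
      linarith

/-- The drain time of the `b`-th block of `l + 1` jobs in reversed order. -/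
def blockTime (s : ℕ) {k : ℕ} (l : ℕ) (q : ℕ → Fin k → ℝ) (b : ℕ) : ℝ :=
  drainTime s l fun m => q (rev ((b + 1) * (l + 1)) m)

/-- The reversed waiting times are dominated by the supremum of a walk, which drifts downwards if
the mean drain time of a block is less than the mean time in which a block arrives. -/
lemma revWaitingTime_mul_le (hk : 1 ≤ k) (hks : k ≤ s) {t : ℕ → ℝ} {q : ℕ → Fin k → ℝ}
    (ht : ∀ n, 0 ≤ t n) {l : ℕ} {K : ℝ} (hK0 : 0 ≤ K)
    (hK : ∀ b, ∑ b' ∈ Finset.range (b + 1), blockTime s l q b' -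
      ∑ u ∈ Finset.range (b * (l + 1)), t u ≤ K) (j : ℕ) :
    revWaitingTime s t q (j * (l + 1)) ≤ K := by
  set n := j * (l + 1) with hn
  set A := arrivalTime fun i => t (rev n i) with hA
  have hA0 : ∀ i, 0 ≤ A i := arrivalTime_nonneg fun i => ht _
  have hAn := arrivalTime_rev_add_sum t (le_refl n)
  have h := freeTime_mul_le hk hks (A := A) (q := fun i => q (rev n i)) (l := l)
    (arrivalTime_mono fun i => ht _) hA0 j (G := A n + K) (add_nonneg (hA0 n) hK0) fun b hb => ?_
  · rw [revWaitingTime, waitingTime, startTime, ← hA, sub_le_iff_le_add', max_le_iff]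
    obtain ⟨i, hi⟩ := exists_orderStat_eq hk hks (freeTime s A (fun i => q (rev n i)) n)
    rw [hi]
    exact ⟨by linarith, h i⟩
  · obtain ⟨a, rfl⟩ : ∃ a, j = a + b + 1 := ⟨j - 1 - b, by omega⟩
    have e1 : a + b + 1 - 1 - b = a := by omega
    rw [e1]
    have hmul : n = a * (l + 1) + l + (b * (l + 1) + 1) := by rw [hn]; ring
    have h1 := arrivalTime_rev_add_sum t (show a * (l + 1) + l ≤ n by omega)
    rw [show n - (a * (l + 1) + l) = b * (l + 1) + 1 by omega, Finset.sum_range_succ] at h1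
    rw [Nat.sub_self, Finset.sum_range_zero, add_zero] at hAn
    have h2 := hK b
    have h3 : ∑ b' ∈ Finset.range (b + 1), drainTime s l
        (fun m => q (rev n ((a + b + 1 - 1 - b') * (l + 1) + m))) =
        ∑ b' ∈ Finset.range (b + 1), blockTime s l q b' := by
      refine Finset.sum_congr rfl fun b' hb' => drainTime_congr fun m hm => ?_
      have hb'' := Finset.mem_range.1 hb'
      obtain ⟨c, rfl⟩ : ∃ c, b = b' + c := ⟨b - b', by omega⟩
      have e2 : a + (b' + c) + 1 - 1 - b' = a + c := by omega
      have e3 : n = (a + c) * (l + 1) + (b' + 1) * (l + 1) := by rw [hn]; ring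
      have e4 : l + 1 ≤ (b' + 1) * (l + 1) := Nat.le_mul_of_pos_left _ (by omega)
      rw [e2, rev_of_le (by omega), rev_of_le (by omega)]
      congr 1
      omega
    rw [h3, ← hA] at *
    linarith [ht (b * (l + 1))]

end Reversal

/-! ### Stability below the critical load -/

section Stability

variable {Ω : Type*} [MeasurableSpace Ω] {P : Measure Ω}
  {s k : ℕ} {μ lam : ℝ} {T : ℕ → Ω → ℝ} {Q : ℕ → Fin k → Ω → ℝ}

lemma measurable_drainTime (hk : 1 ≤ k) (hks : k ≤ s) (l : ℕ) :
    Measurable fun q : ℕ → Fin k → ℝ => drainTime s l q := by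
  have h1 := measurable_residual (s := s) hk hks l
  have h2 := measurable_backlogStart (s := s) hk hks l
  refine h2.add (Finset.measurable_sum _ fun i _ => ?_)
  exact ((measurable_pi_apply i).comp h1).abs

lemma freeTime_zero_le_sum (hk : 1 ≤ k) (hks : k ≤ s) {q : ℕ → Fin k → ℝ} (hq : ∀ n j, 0 ≤ q n j)
    (n : ℕ) (i : Fin s) :
    freeTime s (fun _ => 0) q n i ≤ ∑ m ∈ Finset.range n, ∑ j, q m j := by
  induction n generalizing i with
  | zero => simp [freeTime]
  | succ n ih =>
    rw [Finset.sum_range_succ, freeTime_succ, assign_apply]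
    split_ifs with h
    · rw [startTime_zero_eq hk hks hq]
      obtain ⟨i', hi'⟩ := exists_orderStat_eq hk hks (freeTime s (fun _ => 0) q n)
      rw [hi']
      exact add_le_add (ih i') (Finset.single_le_sum (fun j _ => hq n j) (Finset.mem_univ _))
    · exact (ih i).trans (le_add_of_nonneg_right (Finset.sum_nonneg fun j _ => hq n j))

lemma IsServiceProcess.integral_service (hQ : IsServiceProcess P μ Q) (hμ : 0 < μ) (n : ℕ)
    (j : Fin k) : ∫ ω, Q n j ω ∂P = 1 / μ := by
  rw [← integral_id_expMeasure hμ, ← hQ.map_eq n j,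
    integral_map (hQ.measurable n j).aemeasurable (by fun_prop)]

namespace IsQueueInput

lemma reindex (h : IsQueueInput P lam μ T Q) {g : ℕ → ℕ} (hg : Function.Injective g) :
    IsQueueInput P lam μ (fun n => T (g n)) (fun n => Q (g n)) where
  measurable_arrival n := h.measurable_arrival _
  measurable_service n := h.measurable_service _
  map_arrival n := h.map_arrival _
  map_service n := h.map_service _
  indep := by
    have h1 := h.indep.precomp (g := Sum.map g (Prod.map g (id : Fin k → Fin k)))
      (hg.sumMap (hg.prodMap Function.injective_id))
    convert h1 using 1
    funext i
    cases i <;> rfl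

/-- The joint law of the input is determined by the two rates. -/
lemma identDistrib_elim (h : IsQueueInput P lam μ T Q) {T' : ℕ → Ω → ℝ} {Q' : ℕ → Fin k → Ω → ℝ}
    (h' : IsQueueInput P lam μ T' Q') :
    IdentDistrib (fun ω i => Sum.elim T (fun p : ℕ × Fin k => Q p.1 p.2) i ω)
      (fun ω i => Sum.elim T' (fun p : ℕ × Fin k => Q' p.1 p.2) i ω) P P := by
  refine ⟨(measurable_pi_iff.2 h.measurable_elim).aemeasurable,
    (measurable_pi_iff.2 h'.measurable_elim).aemeasurable, ?_⟩
  rw [h.indep.map_fun_eq_infinitePi_map h.measurable_elim,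
    h'.indep.map_fun_eq_infinitePi_map h'.measurable_elim]
  congr 1
  funext i
  cases i
  · exact (h.map_arrival _).trans (h'.map_arrival _).symm
  · exact (h.map_service _ _).trans (h'.map_service _ _).symm

lemma identDistrib_comp (h : IsQueueInput P lam μ T Q) {T' : ℕ → Ω → ℝ} {Q' : ℕ → Fin k → Ω → ℝ}
    (h' : IsQueueInput P lam μ T' Q') {φ : (ℕ → ℝ) × (ℕ → Fin k → ℝ) → ℝ} (hφ : Measurable φ) :
    IdentDistrib (fun ω => φ (fun n => T n ω, fun n j => Q n j ω))
      (fun ω => φ (fun n => T' n ω, fun n j => Q' n j ω)) P P := by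
  have hu : Measurable fun x : ℕ ⊕ ℕ × Fin k → ℝ =>
      ((fun n => x (Sum.inl n), fun n j => x (Sum.inr (n, j))) : (ℕ → ℝ) × (ℕ → Fin k → ℝ)) := by
    fun_prop
  exact (h.identDistrib_elim h').comp (hφ.comp hu)

end IsQueueInput

variable [IsProbabilityMeasure P]

lemma IsServiceProcess.integrable_service (hQ : IsServiceProcess P μ Q) (hμ : 0 < μ) (n : ℕ)
    (j : Fin k) : Integrable (Q n j) P := by
  have h2 := memLp_two_id_expMeasure hμ
  rw [← hQ.map_eq n j, memLp_map_measure_iff aestronglyMeasurable_id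
    (hQ.measurable n j).aemeasurable] at h2
  exact h2.integrable (by norm_num)

/-- The mean drain time of a large block is the number of jobs times the mean gap, up to a
constant. -/
lemma IsServiceProcess.integral_drainTime_le (hQ : IsServiceProcess P μ Q) (hμ : 0 < μ)
    (hk : 1 ≤ k) (hks : k ≤ s) (j : ℕ) :
    Integrable (fun ω => drainTime s (fillJob s k + j) fun m i => Q m i ω) P ∧
      ∫ ω, drainTime s (fillJob s k + j) (fun m i => Q m i ω) ∂P ≤
        fillJob s k * (k * (1 / μ)) + s * (1 / μ) +
          j * (((harmonic s : ℝ) - (harmonic (s - k) : ℝ)) / μ) := by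
  set f := fillJob s k with hf
  have hsum : Integrable (fun ω => ∑ m ∈ Finset.range f, ∑ i, Q m i ω) P :=
    integrable_finsetSum _ fun m _ => integrable_finsetSum _ fun i _ =>
      hQ.integrable_service hμ m i
  have hsm : Measurable fun ω => startTime s (fun _ => 0) (fun m i => Q m i ω) f :=
    (measurable_backlogStart hk hks f).comp hQ.measurable_path
  have hbound : ∀ᵐ ω ∂P, startTime s (fun _ => 0) (fun m i => Q m i ω) f ≤
      ∑ m ∈ Finset.range f, ∑ i, Q m i ω := by
    filter_upwards [hQ.ae_pos hμ] with ω hω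
    have hω' : ∀ n i, 0 ≤ Q n i ω := fun n i => (hω n i).le
    rw [startTime_zero_eq hk hks hω']
    obtain ⟨i', hi'⟩ := exists_orderStat_eq hk hks (freeTime s (fun _ => 0) (fun m i => Q m i ω) f)
    rw [hi']
    exact freeTime_zero_le_sum hk hks hω' f i'
  have hstart : Integrable (fun ω => startTime s (fun _ => 0) (fun m i => Q m i ω) f) P := by
    refine hsum.mono' hsm.aestronglyMeasurable ?_
    filter_upwards [hbound] with ω hω
    rwa [Real.norm_of_nonneg (show 0 ≤ startTime s (fun _ => 0) _ f from le_max_left _ _)]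
  have hstartle : ∫ ω, startTime s (fun _ => 0) (fun m i => Q m i ω) f ∂P ≤
      f * (k * (1 / μ)) := by
    refine (integral_mono_ae hstart hsum hbound).trans_eq ?_
    rw [integral_finsetSum _ fun m _ => integrable_finsetSum _ fun i _ =>
      hQ.integrable_service hμ m i]
    simp only [integral_finsetSum _ fun i _ => hQ.integrable_service hμ _ i,
      hQ.integral_service hμ, Finset.sum_const, Finset.card_univ, Fintype.card_fin,
      Finset.card_range, nsmul_eq_mul]
  have hgap : ∀ i, Integrable (fun ω => backlogGap s (fun m i => Q m i ω) (f + i)) P := fun i =>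
    (hQ.memLp_two_gap hμ hk hks (Nat.le_add_right _ _)).integrable (by norm_num)
  have hgaps : Integrable (fun ω => ∑ i ∈ Finset.range j,
      backlogGap s (fun m i => Q m i ω) (f + i)) P := integrable_finsetSum _ fun i _ => hgap i
  have hresm : Measurable fun ω => residual s (fun m i => Q m i ω) (f + j) :=
    (measurable_residual hk hks _).comp hQ.measurable_path
  have hres : ∀ i : Fin s, P.map (fun ω => residual s (fun m i => Q m i ω) (f + j) i) =
      expMeasure μ := fun i => by
    have := isProbabilityMeasure_expMeasure hμ
    have h1 := hQ.map_residual hμ hk hks (Nat.le_add_right f j)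
    have h2 := (measurePreserving_eval (fun _ : Fin s => expMeasure μ) i).map_eq
    rw [← h1, Measure.map_map (measurable_pi_apply i) hresm] at h2
    exact h2
  have hresi : ∀ i : Fin s, Measurable fun ω => residual s (fun m i => Q m i ω) (f + j) i :=
    fun i => (measurable_pi_apply i).comp hresm
  have hresint : ∀ i : Fin s, Integrable (fun ω => |residual s (fun m i => Q m i ω) (f + j) i|) P :=
    fun i => by
      have h2 := memLp_two_id_expMeasure hμ
      rw [← hres i, memLp_map_measure_iff aestronglyMeasurable_id (hresi i).aemeasurable] at h2
      exact (h2.integrable (by norm_num)).abs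
  have hresmean : ∀ i : Fin s, ∫ ω, |residual s (fun m i => Q m i ω) (f + j) i| ∂P = 1 / μ :=
    fun i => by
      rw [← integral_id_expMeasure hμ, ← hres i,
        integral_map (hresi i).aemeasurable (by fun_prop)]
      refine integral_congr_ae ?_
      filter_upwards [hQ.ae_residual_pos hμ hk hks] with ω hω
      exact abs_of_pos (hω _ (Nat.le_add_right f j) i)
  have hress : Integrable (fun ω => ∑ i, |residual s (fun m i => Q m i ω) (f + j) i|) P :=
    integrable_finsetSum _ fun i _ => hresint i
  simp only [drainTime, backlogStart_add_eq_sum]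
  refine ⟨(hstart.add hgaps).add hress, ?_⟩
  have hadd := integral_add (hstart.add hgaps) hress
  simp only [Pi.add_apply] at hadd
  rw [hadd, integral_add hstart hgaps, integral_finsetSum _ fun i _ => hgap i,
    integral_finsetSum _ fun i _ => hresint i]
  have hmean : ∀ i, ∫ ω, backlogGap s (fun m i => Q m i ω) (f + i) ∂P =
      ((harmonic s : ℝ) - (harmonic (s - k) : ℝ)) / μ := fun i =>
    hQ.integral_gap hμ hk hks (Nat.le_add_right _ _)
  simp only [hresmean, hmean, Finset.sum_const,
    Finset.card_univ, Fintype.card_fin, Finset.card_range, nsmul_eq_mul]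
  linarith

/-- Two walks with linear growth: if the first grows more slowly, it stays below the second up to a
constant. -/
lemma bddAbove_range_sub_of_tendsto {X t : ℕ → ℝ} {x y : ℝ} {L : ℕ} (hL : 0 < L)
    (hX : Tendsto (fun n : ℕ => (∑ i ∈ Finset.range n, X i) / n) atTop (𝓝 x))
    (ht : Tendsto (fun n : ℕ => (∑ i ∈ Finset.range n, t i) / n) atTop (𝓝 y)) (h : x < L * y) :
    BddAbove (Set.range fun b : ℕ =>
      ∑ i ∈ Finset.range (b + 1), X i - ∑ u ∈ Finset.range (b * L), t u) := by
  obtain ⟨r, hxr, hry⟩ := exists_between h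
  have hL' : (0 : ℝ) < L := by exact_mod_cast hL
  have h1 := (hX.comp (tendsto_add_atTop_nat 1)).eventually_lt_const hxr
  have hmul : Tendsto (fun b : ℕ => b * L) atTop atTop := tendsto_id.atTop_mul_const' hL
  have h2 := (ht.comp hmul).eventually_const_lt ((div_lt_iff₀' hL').2 hry)
  refine IsBoundedUnder.bddAbove_range ⟨r, ?_⟩
  rw [eventually_map]
  filter_upwards [h1, h2, eventually_gt_atTop 0] with b hb1 hb2 hb0
  have hb0' : (0 : ℝ) < b := by exact_mod_cast hb0
  simp only [Function.comp_apply] at hb1 hb2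
  rw [div_lt_iff₀ (by positivity)] at hb1
  rw [lt_div_iff₀ (by push_cast; positivity)] at hb2
  push_cast at hb1 hb2
  have e : r / L * (b * L) = r * b := by field_simp
  rw [e] at hb2
  linarith

/-- The times of different blocks are independent, as they depend on different jobs. -/
lemma IsServiceProcess.iIndepFun_blockTime (hQ : IsServiceProcess P μ Q) (hk : 1 ≤ k) (hks : k ≤ s)
    (l : ℕ) : iIndepFun (fun b ω => blockTime s l (fun m i => Q m i ω) b) P := by
  let X : ℕ → Fin (l + 1) × Fin k → Ω → ℝ := fun b p => Q ((b + 1) * (l + 1) - p.1) p.2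
  have hinj : Function.Injective fun p : ℕ × Fin (l + 1) × Fin k =>
      ((p.1 + 1) * (l + 1) - p.2.1, p.2.2) := by
    have hdiv : ∀ b (m : Fin (l + 1)), ((b + 1) * (l + 1) - m - 1) / (l + 1) = b := fun b m => by
      have e : (b + 1) * (l + 1) - m - 1 = l - m + (l + 1) * b := by
        have := m.2
        rw [Nat.succ_mul, mul_comm b]
        omega
      rw [e, Nat.add_mul_div_left _ _ (by omega), Nat.div_eq_of_lt (by omega), zero_add]
    rintro ⟨b, m, i⟩ ⟨b', m', i'⟩ h
    simp only [Prod.mk.injEq] at h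
    obtain ⟨h, rfl⟩ := h
    have hb : b = b' := by rw [← hdiv b m, ← hdiv b' m', h]
    subst hb
    have h1 : (b + 1) * (l + 1) = b * (l + 1) + (l + 1) := Nat.succ_mul _ _
    have : m = m' := Fin.ext (by have := m.2; have := m'.2; omega)
    rw [this]
  have hX := iIndepFun_curry (X := X) (fun b p => hQ.measurable _ _) (hQ.indep.precomp hinj)
  let ext : (Fin (l + 1) × Fin k → ℝ) → ℕ → Fin k → ℝ := fun y m i =>
    if h : m < l + 1 then y (⟨m, h⟩, i) else 0
  have hext : Measurable ext := by
    refine measurable_pi_iff.2 fun m => measurable_pi_iff.2 fun i => ?_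
    by_cases h : m < l + 1
    · simp only [ext, h, dif_pos]; exact measurable_pi_apply _
    · simp only [ext, h, dif_neg, not_false_eq_true]; exact measurable_const
  have h := hX.comp (fun _ y => drainTime s l (ext y))
    fun _ => (measurable_drainTime hk hks l).comp hext
  convert h using 2 with b
  funext ω
  refine drainTime_congr fun m hm => funext fun i => ?_
  have : m ≤ (b + 1) * (l + 1) := hm.le.trans (Nat.le_mul_of_pos_left _ (by omega))
  simp only [ext, X, hm, dif_pos, rev_of_le this]

namespace IsQueueInput

/-- Below the critical load, the reversed waiting times are almost surely bounded. -/
lemma ae_bddAbove_revWaitingTime (h : IsQueueInput P lam μ T Q) (hk : 1 ≤ k) (hks : k ≤ s)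
    (hlam : 0 < lam) (hμ : 0 < μ)
    (hload : ((harmonic s : ℝ) - (harmonic (s - k) : ℝ)) / μ < 1 / lam) :
    ∀ᵐ ω ∂P, BddAbove (Set.range
      (revWaitingTime s (fun n => T n ω) fun n j => Q n j ω)) := by
  set a := ((harmonic s : ℝ) - (harmonic (s - k) : ℝ)) / μ with ha
  set f := fillJob s k with hf
  have hQ := h.service_input
  -- in long blocks, the constant overhead of draining does not matter
  obtain ⟨j, hj⟩ : ∃ j : ℕ, f * (k * (1 / μ)) + s * (1 / μ) + j * a <
      ((f + j + 1 : ℕ) : ℝ) * (1 / lam) := by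
    obtain ⟨j, hj⟩ := exists_nat_gt ((f * (k * (1 / μ)) + s * (1 / μ)) / (1 / lam - a))
    rw [div_lt_iff₀ (by linarith)] at hj
    refine ⟨j, ?_⟩
    push_cast
    have : 0 ≤ ((f : ℝ) + 1) * (1 / lam) := by positivity
    linarith
  set l := f + j with hl
  have hident : ∀ b, IdentDistrib (fun ω => blockTime s l (fun m i => Q m i ω) b)
      (fun ω => blockTime s l (fun m i => Q m i ω) 0) P P := fun b =>
    (h.reindex (rev_injective ((b + 1) * (l + 1)))).identDistrib_comp
      (h.reindex (rev_injective ((0 + 1) * (l + 1))))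
      (φ := fun p => drainTime s l p.2) ((measurable_drainTime hk hks l).comp measurable_snd)
  obtain ⟨hint, hle⟩ := (hQ.reindex (rev_injective ((0 + 1) * (l + 1)))).integral_drainTime_le
    hμ hk hks j
  have hX := strong_law_ae_real (fun b ω => blockTime s l (fun m i => Q m i ω) b) hint
    (fun b b' hbb => (hQ.iIndepFun_blockTime hk hks l).indepFun hbb) hident
  have hT := strong_law_ae_real T ((h.memLp_two_arrival hlam 0).integrable (by norm_num))
    (fun b b' hbb => h.iIndepFun_arrival.indepFun hbb) (fun i => h.identDistrib_arrival i 0)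
  rw [h.integral_arrival hlam 0] at hT
  filter_upwards [hX, hT, h.ae_arrival_pos hlam] with ω hω1 hω2 hpos
  have hpos' : ∀ n, 0 ≤ T n ω := fun n => (hpos n).le
  obtain ⟨K, hK⟩ := bddAbove_range_sub_of_tendsto (Nat.succ_pos l) hω1 hω2 (hle.trans_lt hj)
  refine ⟨max K 0, ?_⟩
  rintro _ ⟨n, rfl⟩
  refine (monotone_revWaitingTime hk hks hpos' _
    (Nat.le_mul_of_pos_right n (Nat.succ_pos l))).trans ?_
  exact revWaitingTime_mul_le hk hks hpos' (le_max_right _ _)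
    (fun b => (hK ⟨b, rfl⟩).trans (le_max_left _ _)) n

end IsQueueInput

/-- Loynes' argument: delays with the same laws as the members of an increasing, almost surely
bounded sequence are stable. -/
lemma stableDelay_of_identDistrib {X M : ℕ → Ω → ℝ} (h : ∀ n, IdentDistrib (X n) (M n) P P)
    (hmono : ∀ᵐ ω ∂P, Monotone fun n => M n ω)
    (hbdd : ∀ᵐ ω ∂P, BddAbove (Set.range fun n => M n ω)) : StableDelay P X := by
  have hM : ∀ n, AEMeasurable (M n) P := fun n => (h n).aemeasurable_snd
  have hlim : ∀ᵐ ω ∂P, ∃ z, Tendsto (fun n => M n ω) atTop (𝓝 z) := by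
    filter_upwards [hmono, hbdd] with ω h1 h2
    exact ⟨_, tendsto_atTop_ciSup h1 h2⟩
  obtain ⟨Z, hZm, hZ⟩ := measurable_limit_of_tendsto_metrizable_ae hM hlim
  have hpr := Measure.isProbabilityMeasure_map (μ := P) hZm.aemeasurable
  have hd := tendstoInDistribution_of_ae_tendsto hM hZm.aemeasurable hZ
  refine ⟨P.map Z, hpr, fun n => (h n).aemeasurable_fst, aemeasurable_id, ?_⟩
  have e := hd.tendsto
  have e1 : ∀ n, P.map (X n) = P.map (M n) := fun n => (h n).map_eq
  simp only [e1, Measure.map_id]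
  exact e

lemma measurable_waitingTime (hk : 1 ≤ k) (hks : k ≤ s) (n : ℕ) :
    Measurable fun p : (ℕ → ℝ) × (ℕ → Fin k → ℝ) => waitingTime s (arrivalTime p.1) p.2 n := by
  have hA : Measurable fun p : (ℕ → ℝ) × (ℕ → Fin k → ℝ) => arrivalTime p.1 :=
    measurable_pi_iff.2 fun m => Finset.measurable_sum _ fun i _ => by fun_prop
  have h1 := (measurable_startTime (s := s) hk hks n).comp (hA.prodMk measurable_snd)
  exact h1.sub ((measurable_pi_apply n).comp hA)

theorem stableDelay_waitingTime (h : IsQueueInput P lam μ T Q) (hk : 1 ≤ k) (hks : k ≤ s)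
    (hlam : 0 < lam) (hμ : 0 < μ)
    (hload : ((harmonic s : ℝ) - (harmonic (s - k) : ℝ)) / μ < 1 / lam) :
    StableDelay P fun n ω =>
      waitingTime s (arrivalTime fun m => T m ω) (fun m j => Q m j ω) n := by
  refine stableDelay_of_identDistrib
    (M := fun n ω => revWaitingTime s (fun m => T m ω) (fun m j => Q m j ω) n)
    (fun n => h.identDistrib_comp (h.reindex (rev_injective n)) (measurable_waitingTime hk hks n))
    ?_ (h.ae_bddAbove_revWaitingTime hk hks hlam hμ hload)
  filter_upwards [h.ae_arrival_pos hlam] with ω hω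
  exact monotone_revWaitingTime hk hks (fun n => (hω n).le) _

lemma sojournTime_eq (A : ℕ → ℝ) (q : ℕ → Fin k → ℝ) (n : ℕ) :
    sojournTime s A q n = waitingTime s A q n + ⨆ i, q n i := by
  rw [sojournTime, departTime, waitingTime]
  ring

theorem stableDelay_sojournTime (h : IsQueueInput P lam μ T Q) (hk : 1 ≤ k) (hks : k ≤ s)
    (hlam : 0 < lam) (hμ : 0 < μ)
    (hload : ((harmonic s : ℝ) - (harmonic (s - k) : ℝ)) / μ < 1 / lam) :
    StableDelay P fun n ω =>
      sojournTime s (arrivalTime fun m => T m ω) (fun m j => Q m j ω) n := by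
  -- after reversal, the last job is job `0` for every `n`
  have hrev : ∀ n ω, sojournTime s (arrivalTime fun m => T (rev n m) ω)
      (fun m j => Q (rev n m) j ω) n =
      revWaitingTime s (fun m => T m ω) (fun m j => Q m j ω) n + ⨆ i, Q 0 i ω := fun n ω => by
    rw [sojournTime_eq, rev_of_le le_rfl, Nat.sub_self]
    rfl
  have hmeas : ∀ n, Measurable fun p : (ℕ → ℝ) × (ℕ → Fin k → ℝ) =>
      sojournTime s (arrivalTime p.1) p.2 n := fun n => by
    simp only [sojournTime_eq]
    exact (measurable_waitingTime hk hks n).add (.iSup fun i => by fun_prop)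
  refine stableDelay_of_identDistrib
    (fun n => h.identDistrib_comp (h.reindex (rev_injective n)) (hmeas n)) ?_ ?_
  · filter_upwards [h.ae_arrival_pos hlam] with ω hω
    simp only [hrev]
    exact (monotone_revWaitingTime hk hks (fun n => (hω n).le) _).add_const _
  · filter_upwards [h.ae_bddAbove_revWaitingTime hk hks hlam hμ hload] with ω hω
    simp only [hrev]
    obtain ⟨K, hK⟩ := hω
    refine ⟨K + ⨆ i, Q 0 i ω, ?_⟩
    rintro _ ⟨n, rfl⟩
    exact add_le_add_left (hK ⟨n, rfl⟩) _

end Stability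

end BEM

end

theorem mainTheorem5 {Ω : Type*} [MeasurableSpace Ω] (P : Measure Ω) [IsProbabilityMeasure P]
    (s k : ℕ) (hk : 1 ≤ k) (hks : k ≤ s) (lam μ : ℝ) (hlam : 0 < lam) (hμ : 0 < μ)
    -- `T n`: inter-arrival times, `Q n i`: service time of task `i` of job `n`
    (T : ℕ → Ω → ℝ) (Q : ℕ → Fin k → Ω → ℝ)
    (hTm : ∀ n, Measurable (T n)) (hQm : ∀ n i, Measurable (Q n i))
    (hT : ∀ n, P.map (T n) = expMeasure lam)
    (hQ : ∀ n i, P.map (Q n i) = expMeasure μ)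
    (hindep : iIndepFun (Sum.elim T (fun p : ℕ × Fin k => Q p.1 p.2)) P) :
    -- under backlog, once the workers are filled, all workers are busy after each job start,
    (∀ᵐ ω ∂P, ∀ n : ℕ, s ≤ (n + 1) * k → ∀ i : Fin s,
      BEM.startTime s (fun _ => 0) (fun m j => Q m j ω) n <
        BEM.freeTime s (fun _ => 0) (fun m j => Q m j ω) (n + 1) i) ∧
    -- the times between job starts are independent,
    iIndepFun (fun (n : {n : ℕ // s ≤ (n + 1) * k}) ω =>
      BEM.backlogGap s (fun m j => Q m j ω) n) P ∧
    -- distributed as the `k`-th order statistic, with the stated mean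
    (∀ n : ℕ, s ≤ (n + 1) * k →
      HasLaw (fun ω => BEM.backlogGap s (fun m j => Q m j ω) n) (BEM.expOrderStatLaw s k μ) P ∧
      Integrable (fun ω => BEM.backlogGap s (fun m j => Q m j ω) n) P ∧
      ∫ ω, BEM.backlogGap s (fun m j => Q m j ω) n ∂P =
        ((harmonic s : ℝ) - (harmonic (s - k) : ℝ)) / μ) ∧
    -- stability condition, for the waiting times and for the sojourn times
    (BEM.StableDelay P (fun n ω =>
        BEM.waitingTime s (BEM.arrivalTime fun m => T m ω) (fun m j => Q m j ω) n) ↔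
      BEM.utilization s k lam μ < BEM.maxUtilization s k) ∧
    (BEM.StableDelay P (fun n ω =>
        BEM.sojournTime s (BEM.arrivalTime fun m => T m ω) (fun m j => Q m j ω) n) ↔
      BEM.utilization s k lam μ < BEM.maxUtilization s k) ∧
    -- the second form of the bound
    BEM.maxUtilization s k =
      1 / ∑ j ∈ Finset.range k, 1 / ((k : ℝ) - (j : ℝ) * ((k : ℝ) / (s : ℝ))) ∧
    -- the limit as `k / s → 0`, over all pairs `(s', k')` with `1 ≤ k' ≤ s'`
    Tendsto (fun p : ℕ × ℕ => BEM.maxUtilization p.1 p.2)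
      (comap (fun p : ℕ × ℕ => (p.2 : ℝ) / (p.1 : ℝ)) (𝓝 0) ⊓
        𝓟 {p : ℕ × ℕ | 1 ≤ p.2 ∧ p.2 ≤ p.1})
      (𝓝 1) := by
  have hin : BEM.IsQueueInput P lam μ T Q := ⟨hTm, hQm, hT, hQ, hindep⟩
  have hserv := hin.service_input
  have hfill : ∀ {n : ℕ}, s ≤ (n + 1) * k → BEM.fillJob s k ≤ n :=
    (BEM.fillJob_le_iff hk hks).2
  -- a job starts no earlier than under backlog, so its delay is at least the backlog deficit
  have hwait : ∀ᵐ ω ∂P, ∀ n, BEM.startTime s (fun _ => 0) (fun m j => Q m j ω) n -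
      BEM.arrivalTime (fun m => T m ω) n ≤
        BEM.waitingTime s (BEM.arrivalTime fun m => T m ω) (fun m j => Q m j ω) n := by
    filter_upwards [hin.ae_arrival_pos hlam] with ω hω n
    exact sub_le_sub_right (BEM.backlogStart_le_startTime hk hks
      (BEM.arrivalTime_nonneg fun m => (hω m).le) _ n) _
  refine ⟨?_, ?_, fun n hn => ?_, ?_, ?_, BEM.maxUtilization_eq hk hks, BEM.tendsto_maxUtilization⟩
  · filter_upwards [hserv.ae_residual_pos hμ hk hks] with ω hω n hn i
    exact sub_pos.1 (hω n (hfill hn) i)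
  · exact (hserv.iIndepFun_gap hμ hk hks).precomp
      (g := fun n : {n : ℕ // s ≤ (n + 1) * k} =>
        (⟨n, hfill n.2⟩ : {n : ℕ // BEM.fillJob s k ≤ n}))
      fun n n' h => Subtype.ext (by simpa using h)
  · exact ⟨hserv.hasLaw_gap hμ hk hks (hfill hn),
      (hserv.memLp_two_gap hμ hk hks (hfill hn)).integrable (by norm_num),
      hserv.integral_gap hμ hk hks (hfill hn)⟩
  · rw [BEM.utilization_lt_maxUtilization_iff hk hks hμ hlam]
    exact ⟨fun h => BEM.lt_of_stableDelay hin hk hks hlam hμ h hwait,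
      BEM.stableDelay_waitingTime hin hk hks hlam hμ⟩
  · rw [BEM.utilization_lt_maxUtilization_iff hk hks hμ hlam]
    refine ⟨fun h => BEM.lt_of_stableDelay hin hk hks hlam hμ h ?_,
      BEM.stableDelay_sojournTime hin hk hks hlam hμ⟩
    filter_upwards [hwait, hserv.ae_pos hμ] with ω hω hq n
    rw [BEM.sojournTime_eq]
    exact (hω n).trans (le_add_of_nonneg_right (Real.iSup_nonneg fun j => (hq n j).le))
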